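/- Let $K$ be any field, let $>$ be the degree reverse lexicographical ordering on the terms of $K[x,y,z,t]$ with $x>y>z>t$, and let $$F=(f_1,f_2,f_3)=(yz^3-x^2t^2,\;xz^2-y^2t,\;x^2y-z^2t).$$ Run the (incremental, signature-based) algorithm F5 on $F$: starting from $\{f_3\}$, it treats the indices $i=2$ and $i=1$ one after the other. In iteration $i$ it removes all critical pairs of the smallest remaining degree $d$, passes their s-polynomials that are not rejected by the Rewritten Criterion to the subalgorithm Reduction (pairs rejected by Faugère's Criterion are never formed), and adds the set $R_d$ of labeled polynomials returned by Reduction to the current set $G$ of labeled polynomials. For a set $S$ of polynomials let $HT(S)$ be the ideal generated by the head terms of the nonzero elements of $S$, and call a finite generating set of an ideal $I$ a $d$-Gröbner basis of $I$ if each of its s-polynomials of degree at most $d$ has a standard representation. Write $\mathrm{poly}(G)$ for the set of polynomial parts of the elements of $G$. Then, in whatever order critical pairs of equal degree are treated, F5 reaches, in iteration $i=1$, a state in which the smallest degree of a remaining critical pair is $d=8$, the set $\mathrm{poly}(G)$ is a $7$-Gröbner basis of $\langle f_1,f_2,f_3\rangle$, the call of Reduction at degree $8$ terminates, and its result $R_8$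 satisfies (A) $R_8\neq\emptyset$, and (B) $HT(\mathrm{poly}(G\cup R_8))=HT(\mathrm{poly}(G))$. Moreover, no polynomial has been reduced to zero by F5 up to and including this call. In particular it is false that, for every input and every degree $d$, if no polynomial is reduced to zero, then $HT(\mathrm{poly}(G\cup R_d))\neq HT(\mathrm{poly}(G))$ whenever $R_d\neq\emptyset$. -/

import Mathlib

noncomputable section

open scoped MonomialOrder Classical

/-! ### The degree reverse lexicographical ordering -/

/-- A type synonym of the exponent vectors, to be ordered by degree and then reverse
lexicographically. -/
def DegRevLexSyn (n : ℕ) : Type := Fin n →₀ ℕ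

namespace DegRevLexSyn

variable {n : ℕ}

instance : AddCommMonoid (DegRevLexSyn n) := inferInstanceAs (AddCommMonoid (Fin n →₀ ℕ))

/-- The sort key of an exponent vector: first the degree; for equal degrees the smaller exponent
at the last variable where two vectors differ wins. -/
def key (a : DegRevLexSyn n) : ℕ ×ₗ (Colex (Fin n →₀ ℕ))ᵒᵈ :=
  toLex (Finsupp.degree (show Fin n →₀ ℕ from a),
    OrderDual.toDual (toColex (show Fin n →₀ ℕ from a)))

theorem key_injective : Function.Injective (key (n := n)) := by
  intro a b h
  have h2 := congrArg (fun x => (ofLex x).2) h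
  exact h2

instance : LinearOrder (DegRevLexSyn n) := LinearOrder.lift' key key_injective

theorem lt_iff_key {a b : DegRevLexSyn n} : a < b ↔ key a < key b := Iff.rfl

theorem le_iff_key {a b : DegRevLexSyn n} : a ≤ b ↔ key a ≤ key b := Iff.rfl

theorem lt_iff {a b : Fin n →₀ ℕ} :
    (show DegRevLexSyn n from a) < (show DegRevLexSyn n from b) ↔
      a.degree < b.degree ∨
        a.degree = b.degree ∧ ∃ i, (∀ j, i < j → a j = b j) ∧ b i < a i := by
  rw [lt_iff_key]
  simp only [key, Prod.Lex.toLex_lt_toLex, OrderDual.toDual_lt_toDual, Finsupp.Colex.lt_iff]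
  refine or_congr Iff.rfl (and_congr Iff.rfl ⟨?_, ?_⟩)
  · rintro ⟨i, h, h'⟩
    exact ⟨i, fun j hj => (h j hj).symm, h'⟩
  · rintro ⟨i, h, h'⟩
    exact ⟨i, fun j hj => (h j hj).symm, h'⟩

theorem key_add_le {a b : DegRevLexSyn n} (h : key a ≤ key b) (c : DegRevLexSyn n) :
    key (a + c) ≤ key (b + c) := by
  simp only [key, Prod.Lex.toLex_le_toLex, OrderDual.toDual_le_toDual] at h ⊢
  have hd : ∀ x y : Fin n →₀ ℕ, Finsupp.degree (x + y) = Finsupp.degree x + Finsupp.degree y :=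
    fun x y => map_add _ x y
  rcases h with h | ⟨h, h'⟩
  · left
    exact (hd a c).trans_lt ((Nat.add_lt_add_right h _).trans_eq (hd b c).symm)
  · right
    refine ⟨(hd a c).trans ((congrArg (· + _) h).trans (hd b c).symm), ?_⟩
    exact add_le_add_left h' (toColex (show Fin n →₀ ℕ from c))

instance : IsOrderedAddMonoid (DegRevLexSyn n) where
  add_le_add_left _ _ h c := key_add_le h c

theorem monotone_of : Monotone (fun a : Fin n →₀ ℕ => (show DegRevLexSyn n from a)) := by
  intro a b h
  obtain ⟨c, rfl⟩ := exists_add_of_le h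
  have h0 : key (show DegRevLexSyn n from (0 : Fin n →₀ ℕ)) ≤ key (show DegRevLexSyn n from c) := by
    simp only [key, Prod.Lex.toLex_le_toLex, OrderDual.toDual_le_toDual]
    rcases Nat.eq_zero_or_pos c.degree with hc | hc
    · right
      have : c = 0 := (Finsupp.degree_eq_zero_iff c).1 hc
      subst this
      exact ⟨rfl, le_rfl⟩
    · left
      simpa using hc
  have h1 := key_add_le h0 (show DegRevLexSyn n from a)
  have e1 : (show DegRevLexSyn n from (0 : Fin n →₀ ℕ)) + (show DegRevLexSyn n from a)
      = (show DegRevLexSyn n from a) := zero_add (M := Fin n →₀ ℕ) a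
  have e2 : (show DegRevLexSyn n from c) + (show DegRevLexSyn n from a)
      = (show DegRevLexSyn n from (a + c)) := add_comm (G := Fin n →₀ ℕ) c a
  rw [e1, e2] at h1
  exact h1

instance : WellFoundedLT (DegRevLexSyn n) := by
  have : WellQuasiOrderedLE (DegRevLexSyn n) :=
    Monotone.wellQuasiOrderedLE_of_wellQuasiOrderedLE_of_surjective (α := Fin n →₀ ℕ) monotone_of (fun a => ⟨a, rfl⟩)
  infer_instance

end DegRevLexSyn

/-- The degree reverse lexicographical ordering with `X 0 > X 1 > ⋯ > X (n - 1)`. -/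
def degRevLex (n : ℕ) : MonomialOrder (Fin n) where
  syn := DegRevLexSyn n
  toSyn :=
    { toFun := fun a => a
      invFun := fun a => a
      left_inv := fun _ => rfl
      right_inv := fun _ => rfl
      map_add' := fun _ _ => rfl }
  toSyn_monotone := DegRevLexSyn.monotone_of

theorem degRevLex_lt_iff {n : ℕ} {a b : Fin n →₀ ℕ} :
    a ≺[degRevLex n] b ↔
      a.degree < b.degree ∨
        a.degree = b.degree ∧ ∃ i, (∀ j, i < j → a j = b j) ∧ b i < a i :=
  DegRevLexSyn.lt_iff (a := a) (b := b)

/-! ### Gröbner basics -/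

section Groebner

variable {σ K : Type*} [Field K] (ord : MonomialOrder σ)

/-- `HT(S)`: the ideal generated by the head terms of the nonzero elements of `S`. -/
def headIdeal (S : Set (MvPolynomial σ K)) : Ideal (MvPolynomial σ K) :=
  Ideal.span {q | ∃ p ∈ S, p ≠ 0 ∧ q = MvPolynomial.monomial (ord.degree p) 1}

/-- `p` has a standard representation with respect to `G`. -/
def HasStdRep (G : Set (MvPolynomial σ K)) (p : MvPolynomial σ K) : Prop :=
  p = 0 ∨ ∃ (k : ℕ) (c q : Fin k → MvPolynomial σ K),
    (∀ i, q i ∈ G) ∧ p = ∑ i, c i * q i ∧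
      ∀ i, c i * q i ≠ 0 → ord.degree (c i * q i) ≼[ord] ord.degree p

/-- `G` is a `d`-Gröbner basis of `I`: a basis of `I` such that all s-polynomials up to degree `d`
have standard representations. -/
def IsGroebnerUpTo (d : ℕ) (G : Set (MvPolynomial σ K)) (I : Ideal (MvPolynomial σ K)) : Prop :=
  G.Finite ∧ Ideal.span G = I ∧
    ∀ p ∈ G, ∀ q ∈ G, (ord.sPolynomial p q).totalDegree ≤ d →
      HasStdRep ord G (ord.sPolynomial p q)

/-- One reduction step modulo `B`: a term of `p` which is a multiple of the head term of some
`b ∈ B` is cancelled by the corresponding multiple of `b`. -/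
def ReducesTo (B : Set (MvPolynomial σ K)) (p p' : MvPolynomial σ K) : Prop :=
  ∃ b ∈ B, b ≠ 0 ∧ ∃ e ∈ p.support, ord.degree b ≤ e ∧
    p' = p - MvPolynomial.monomial (e - ord.degree b) (p.coeff e / ord.leadingCoeff b) * b

/-- `q` is a normal form of `p` modulo `B`: `p` reduces to `q`, and `q` is irreducible. -/
def IsNormalForm (B : Set (MvPolynomial σ K)) (p q : MvPolynomial σ K) : Prop :=
  Relation.ReflTransGen (ReducesTo ord B) p q ∧ ∀ q', ¬ ReducesTo ord B q q'

/-- The normal form `φ(p, B)`; it is unique when `B` is a Gröbner basis. -/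
def normalForm (B : Set (MvPolynomial σ K)) (p : MvPolynomial σ K) : MvPolynomial σ K :=
  Classical.epsilon (IsNormalForm ord B p)

/-- `p` divided by its head coefficient. -/
def makeMonic (p : MvPolynomial σ K) : MvPolynomial σ K :=
  MvPolynomial.C (ord.leadingCoeff p)⁻¹ * p

end Groebner

/-! ### The algorithm F5

The input is a list `f_0, …, f_m` (indices start at `0`). The iterations run through the indices
`m, m - 1, …, 0`; iteration `i` turns a Gröbner basis of `⟨f_{i+1}, …, f_m⟩` into one of
`⟨f_i, …, f_m⟩`. -/

namespace F5

variable {σ K : Type*} [Field K] {m : ℕ} (ord : MonomialOrder σ)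

/-- The signature `t 𝐅_i`. -/
structure Signature (σ : Type*) (m : ℕ) where
  term : σ →₀ ℕ
  idx : Fin (m + 1)

/-- The ordering `≺` of signatures: a larger index means a smaller signature. -/
def Signature.Lt (s t : Signature σ m) : Prop :=
  t.idx < s.idx ∨ s.idx = t.idx ∧ s.term ≺[ord] t.term

def Signature.Le (s t : Signature σ m) : Prop :=
  s = t ∨ s.Lt ord t

/-- `u (t 𝐅_i) = (u t) 𝐅_i`. -/
def Signature.shift (u : σ →₀ ℕ) (s : Signature σ m) : Signature σ m :=
  ⟨u + s.term, s.idx⟩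

/-- A labeled polynomial `r_k`, together with its number `k`. -/
structure LabeledPoly (σ K : Type*) [Field K] (m : ℕ) where
  num : ℕ
  sig : Signature σ m
  poly : MvPolynomial σ K

/-- The head term of the polynomial part. -/
def LabeledPoly.ht (r : LabeledPoly σ K m) : σ →₀ ℕ := ord.degree r.poly

/-- `poly(G)`. -/
def polys (G : List (LabeledPoly σ K m)) : Set (MvPolynomial σ K) :=
  {p | ∃ r ∈ G, r.poly = p}

/-- `poly(G_{i+1})`: the polynomial parts of the elements of `G` of index greater than `i`. -/
def polysAbove (i : Fin (m + 1)) (G : List (LabeledPoly σ K m)) : Set (MvPolynomial σ K) :=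
  {p | ∃ r ∈ G, i < r.sig.idx ∧ r.poly = p}

/-- `u r` is detected by Faugère's Criterion. -/
def FaugereDetected (G : List (LabeledPoly σ K m)) (u : σ →₀ ℕ) (r : LabeledPoly σ K m) : Prop :=
  ∃ g ∈ G, r.sig.idx < g.sig.idx ∧ g.ht ord ≤ u + r.sig.term

/-- The list of rules: the signature and the number of every labeled polynomial created by `spol`
or `topReduction`, whether it is already in `G`, still being reduced, or was reduced to zero. -/
abbrev Rules (σ : Type*) (m : ℕ) := List (Signature σ m × ℕ)

/-- `u r` is detected by the Rewritten Criterion: a labeled polynomial of the same index that was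
created later than `r` has a signature term dividing that of `u r`. -/
def Rewritten (rules : Rules σ m) (u : σ →₀ ℕ) (r : LabeledPoly σ K m) : Prop :=
  ∃ a ∈ rules, a.1.idx = r.sig.idx ∧ r.num < a.2 ∧ a.1.term ≤ u + r.sig.term

/-- A critical pair; its s-polynomial is `u₁ r₁ - u₂ r₂`, and `r₁` carries the larger
signature. -/
structure CritPair (σ K : Type*) [Field K] (m : ℕ) where
  lcm : σ →₀ ℕ
  u₁ : σ →₀ ℕ
  r₁ : LabeledPoly σ K m
  u₂ : σ →₀ ℕ
  r₂ : LabeledPoly σ K m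

/-- The degree of a critical pair. -/
def CritPair.deg (p : CritPair σ K m) : ℕ := p.lcm.degree

/-- The critical pair of `r` and `s`, without any test. -/
def orientedPair (r s : LabeledPoly σ K m) : CritPair σ K m :=
  let t := r.ht ord ⊔ s.ht ord
  let u := t - r.ht ord
  let v := t - s.ht ord
  if (r.sig.shift u).Lt ord (s.sig.shift v) then ⟨t, v, s, u, r⟩ else ⟨t, u, r, v, s⟩

/-- `CritPair`: the critical pair of `r` and `s` in iteration `i`, unless Faugère's Criterion
rejects one of its components of index `i`. The components of larger index come from an earlier,
finished iteration and are not tested. -/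
def critPair (i : Fin (m + 1)) (G : List (LabeledPoly σ K m)) (r s : LabeledPoly σ K m) :
    Option (CritPair σ K m) :=
  let p := orientedPair ord r s
  if i < p.r₁.sig.idx then none
  else if FaugereDetected ord G p.u₁ p.r₁ then none
  else if p.r₂.sig.idx = i ∧ FaugereDetected ord G p.u₂ p.r₂ then none
  else some p

/-- The data of a call of `Reduction`: `todo` is kept sorted by increasing signature, `done`
collects the result `R_d`, `count` is the number of labeled polynomials created so far (and the
number of the next one), and `zeros` lists the labeled polynomials that were reduced to zero since
the start of the algorithm. -/
structure RedState (σ K : Type*) [Field K] (m : ℕ) where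
  todo : List (LabeledPoly σ K m)
  done : List (LabeledPoly σ K m)
  count : ℕ
  rules : Rules σ m
  zeros : List (LabeledPoly σ K m)

/-- Insertion into a list sorted by increasing signature. -/
def insertBySig (r : LabeledPoly σ K m) (l : List (LabeledPoly σ K m)) :
    List (LabeledPoly σ K m) :=
  l.orderedInsert (fun a b => a.sig.Le ord b.sig) r

/-- `Spol`: the pairs are treated one after the other; a pair with a component that is detected by
the Rewritten Criterion is dropped, any other pair gives a new labeled polynomial and a new rule. -/
def spol : List (CritPair σ K m) → RedState σ K m → RedState σ K m
  | [], s => s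
  | p :: ps, s =>
    if Rewritten s.rules p.u₁ p.r₁ ∨ Rewritten s.rules p.u₂ p.r₂ then spol ps s
    else
      let r : LabeledPoly σ K m :=
        ⟨s.count, p.r₁.sig.shift p.u₁,
          MvPolynomial.monomial p.u₁ 1 * p.r₁.poly - MvPolynomial.monomial p.u₂ 1 * p.r₂.poly⟩
      spol ps
        { s with
          todo := insertBySig ord r s.todo
          count := s.count + 1
          rules := (r.sig, r.num) :: s.rules }

/-- `g` is an admissible reducer of `r` in iteration `i`: neither criterion detects the multiple
`u g` with the head term of `r`, and its signature is not that of `r`. -/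
def IsReducer (i : Fin (m + 1)) (G : List (LabeledPoly σ K m)) (rules : Rules σ m)
    (r g : LabeledPoly σ K m) : Prop :=
  g.sig.idx = i ∧ g.ht ord ≤ r.ht ord ∧
    ¬ FaugereDetected ord G (r.ht ord - g.ht ord) g ∧
    ¬ Rewritten rules (r.ht ord - g.ht ord) g ∧
    g.sig.shift (r.ht ord - g.ht ord) ≠ r.sig

/-- `IsReducible`: the first admissible reducer in the list, if there is one. -/
def findReducer (i : Fin (m + 1)) (G : List (LabeledPoly σ K m)) (rules : Rules σ m)
    (r : LabeledPoly σ K m) : Option (LabeledPoly σ K m) :=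
  G.find? (fun g => decide (IsReducer ord i G rules r g))

/-- `TopReduction`, applied to `r`, which has been removed from `todo`. -/
def topReduction (i : Fin (m + 1)) (G : List (LabeledPoly σ K m)) (r : LabeledPoly σ K m)
    (s : RedState σ K m) : RedState σ K m :=
  if r.poly = 0 then { s with zeros := s.zeros ++ [r] }
  else
    match findReducer ord i (G ++ s.done) s.rules r with
    | none => { s with done := s.done ++ [{ r with poly := makeMonic ord r.poly }] }
    | some g =>
      let u := r.ht ord - g.ht ord
      let c := ord.leadingCoeff r.poly
      if (g.sig.shift u).Lt ord r.sig then
        { s with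
          todo := insertBySig ord
            { r with poly := r.poly - MvPolynomial.monomial u c * g.poly } s.todo }
      else
        let r' : LabeledPoly σ K m :=
          ⟨s.count, g.sig.shift u, MvPolynomial.monomial u c * g.poly - r.poly⟩
        { s with
          todo := insertBySig ord r' (insertBySig ord r s.todo)
          count := s.count + 1
          rules := (r'.sig, r'.num) :: s.rules }

/-- One pass of the loop of `Reduction`: the element of `todo` of smallest signature is replaced by
its normal form with respect to `G_{i+1}` and handed to `topReduction`. -/
def reductionStep (i : Fin (m + 1)) (G : List (LabeledPoly σ K m)) (s : RedState σ K m) :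
    RedState σ K m :=
  match s.todo with
  | [] => s
  | r :: rest =>
    topReduction ord i G { r with poly := normalForm ord (polysAbove i G) r.poly }
      { s with todo := rest }

/-- `Reduction`: the loop is run until `todo` is empty. The value is `none` if this never
happens. -/
def reduction (i : Fin (m + 1)) (G : List (LabeledPoly σ K m)) (s : RedState σ K m) :
    Option (RedState σ K m) :=
  if h : ∃ n, ((reductionStep ord i G)^[n] s).todo = [] then
    some ((reductionStep ord i G)^[Nat.find h] s)
  else none

/-- The state of F5 between two degree steps of iteration `cur`. -/
structure State (σ K : Type*) [Field K] (m : ℕ) where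
  cur : Fin (m + 1)
  G : List (LabeledPoly σ K m)
  pairs : List (CritPair σ K m)
  count : ℕ
  rules : Rules σ m
  zeros : List (LabeledPoly σ K m)

/-- `r_i = (𝐅_i, f_i)`, with `f_i` made monic; it has the number `i`. -/
def inputPoly (F : Fin (m + 1) → MvPolynomial σ K) (i : Fin (m + 1)) : LabeledPoly σ K m :=
  ⟨i, ⟨0, i⟩, makeMonic ord (F i)⟩

/-- The start: `G` holds only the last input polynomial. -/
def State.init (F : Fin (m + 1) → MvPolynomial σ K) : State σ K m :=
  ⟨Fin.last m, [inputPoly ord F (Fin.last m)], [], m + 1, [], []⟩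

/-- The beginning of iteration `i`. -/
def State.startIteration (F : Fin (m + 1) → MvPolynomial σ K) (i : Fin (m + 1))
    (s : State σ K m) : State σ K m :=
  { s with
    cur := i
    G := s.G ++ [inputPoly ord F i]
    pairs := s.G.filterMap (critPair ord i s.G (inputPoly ord F i)) }

/-- The smallest degree `d` of a critical pair that is left. -/
def State.nextDegree (s : State σ K m) : Option ℕ := (s.pairs.map CritPair.deg).min?

/-- `Spol` and `Reduction` for the pairs of degree `d`; the field `done` of the value is `R_d`.
The function `sel` decides in which order the pairs of the same degree are treated. -/
def State.reduceDegree (sel : List (CritPair σ K m) → List (CritPair σ K m)) (d : ℕ)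
    (s : State σ K m) : Option (RedState σ K m) :=
  reduction ord s.cur s.G
    (spol ord (sel (s.pairs.filter (fun p => p.deg = d))) ⟨[], [], s.count, s.rules, s.zeros⟩)

/-- Add `r` to `G`, after forming its critical pairs with the elements of `G`. -/
def State.addPoly (s : State σ K m) (r : LabeledPoly σ K m) : State σ K m :=
  { s with
    pairs := s.pairs ++ s.G.filterMap (critPair ord s.cur s.G r)
    G := s.G ++ [r] }

/-- The effect of the degree step `d` whose call of `Reduction` ended with `t`. -/
def State.finishDegree (d : ℕ) (s : State σ K m) (t : RedState σ K m) : State σ K m :=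
  t.done.foldl (State.addPoly ord)
    { s with
      pairs := s.pairs.filter (fun p => p.deg ≠ d)
      count := t.count
      rules := t.rules
      zeros := t.zeros }

/-- One step of F5: a degree step if there are critical pairs, otherwise the beginning of the next
iteration. The value is `none` after the end of the last iteration. -/
def State.step (sel : List (CritPair σ K m) → List (CritPair σ K m))
    (F : Fin (m + 1) → MvPolynomial σ K) (s : State σ K m) : Option (State σ K m) :=
  match s.nextDegree with
  | some d => (s.reduceDegree ord sel d).map (s.finishDegree ord d)
  | none =>
    if s.cur = 0 then none
    else some (s.startIteration ord F ⟨s.cur - 1, by omega⟩)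

/-- The state of F5 on the input `F` after `n` steps. -/
def run (sel : List (CritPair σ K m) → List (CritPair σ K m))
    (F : Fin (m + 1) → MvPolynomial σ K) : ℕ → Option (State σ K m)
  | 0 => some (State.init ord F)
  | n + 1 => (run sel F n).bind (State.step ord sel F)

end F5

/-- The input `(y z³ - x² t², x z² - y² t, x² y - z² t)`; the variables `x, y, z, t` are
`X 0, X 1, X 2, X 3`. -/
def faugereInput (K : Type*) [Field K] : Fin 3 → MvPolynomial (Fin 4) K :=
  let x := MvPolynomial.X 0
  let y := MvPolynomial.X 1
  let z := MvPolynomial.X 2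
  let t := MvPolynomial.X 3
  ![y * z ^ 3 - x ^ 2 * t ^ 2, x * z ^ 2 - y ^ 2 * t, x ^ 2 * y - z ^ 2 * t]

end

open scoped MonomialOrder

/-! ### Rewriting of exponent vectors by binomials -/

section Rewriting

variable {σ : Type*}

/-- One rewriting step: `w + b.1` is replaced by `w + b.2` for some `b ∈ B`. -/
def Rewrites (B : Set ((σ →₀ ℕ) × (σ →₀ ℕ))) (a a' : σ →₀ ℕ) : Prop :=
  ∃ b ∈ B, ∃ w, a = w + b.1 ∧ a' = w + b.2

theorem Rewrites.add_left {B : Set ((σ →₀ ℕ) × (σ →₀ ℕ))} {a a' : σ →₀ ℕ}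
    (h : Rewrites B a a') (w : σ →₀ ℕ) : Rewrites B (w + a) (w + a') := by
  obtain ⟨b, hb, v, rfl, rfl⟩ := h
  exact ⟨b, hb, w + v, (add_assoc _ _ _).symm, (add_assoc _ _ _).symm⟩

theorem Rewrites.reflTransGen_add_left {B : Set ((σ →₀ ℕ) × (σ →₀ ℕ))} {a a' : σ →₀ ℕ}
    (h : Relation.ReflTransGen (Rewrites B) a a') (w : σ →₀ ℕ) :
    Relation.ReflTransGen (Rewrites B) (w + a) (w + a') :=
  Relation.ReflTransGen.lift (w + ·) (fun _ _ h => Rewrites.add_left h w) _ _ h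

/-- All critical pairs of the binomials in `B` are joinable. -/
def CritJoinable (B : Set ((σ →₀ ℕ) × (σ →₀ ℕ))) : Prop :=
  ∀ b ∈ B, ∀ c ∈ B, Relation.Join (Relation.ReflTransGen (Rewrites B))
    (b.1 ⊔ c.1 - b.1 + b.2) (b.1 ⊔ c.1 - c.1 + c.2)

theorem CritJoinable.join {B : Set ((σ →₀ ℕ) × (σ →₀ ℕ))} (hB : CritJoinable B)
    {a a₁ a₂ : σ →₀ ℕ} (h₁ : Rewrites B a a₁) (h₂ : Rewrites B a a₂) :
    Relation.Join (Relation.ReflTransGen (Rewrites B)) a₁ a₂ := by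
  obtain ⟨b, hb, v, rfl, rfl⟩ := h₁
  obtain ⟨c, hc, w, h, rfl⟩ := h₂
  obtain ⟨d, h1, h2⟩ := hB b hb c hc
  have hle : b.1 ⊔ c.1 ≤ v + b.1 := sup_le le_add_self (h ▸ le_add_self)
  obtain ⟨u, hu⟩ := exists_add_of_le hle
  have hv : u + (b.1 ⊔ c.1 - b.1) = v := by
    ext i
    have e := DFunLike.congr_fun hu i
    simp only [Finsupp.add_apply, Finsupp.sup_apply, Finsupp.tsub_apply] at e ⊢
    omega
  have hw : u + (b.1 ⊔ c.1 - c.1) = w := by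
    ext i
    have e := DFunLike.congr_fun hu i
    have e' := DFunLike.congr_fun h i
    simp only [Finsupp.add_apply, Finsupp.sup_apply, Finsupp.tsub_apply] at e e' ⊢
    omega
  refine ⟨u + d, ?_, ?_⟩
  · rw [← hv, add_assoc]
    exact Rewrites.reflTransGen_add_left h1 u
  · rw [← hw, add_assoc]
    exact Rewrites.reflTransGen_add_left h2 u

/-- Newman's lemma: a terminating, locally confluent relation is confluent. -/
theorem Relation.join_of_wellFounded {α : Type*} {r : α → α → Prop}
    (hwf : WellFounded (fun a b => r b a))
    (hloc : ∀ a b c, r a b → r a c → Relation.Join (Relation.ReflTransGen r) b c) (a b c : α)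
    (hb : Relation.ReflTransGen r a b) (hc : Relation.ReflTransGen r a c) :
    Relation.Join (Relation.ReflTransGen r) b c := by
  induction a using hwf.induction generalizing b c with
  | _ a ih =>
    rcases hb.cases_head with rfl | ⟨b', hab, hbb⟩
    · exact ⟨c, hc, .refl⟩
    rcases hc.cases_head with rfl | ⟨c', hac, hcc⟩
    · exact ⟨b, .refl, .head hab hbb⟩
    obtain ⟨d, hbd, hcd⟩ := hloc a b' c' hab hac
    obtain ⟨e, hbe, hde⟩ := ih b' hab b d hbb hbd
    obtain ⟨f, hef, hcf⟩ := ih c' hac e c (hcd.trans hde) hcc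
    exact ⟨f, hbe.trans hef, hcf⟩

variable (ord : MonomialOrder σ)

theorem wellFounded_rewrites {B : Set ((σ →₀ ℕ) × (σ →₀ ℕ))} (hB : ∀ b ∈ B, b.2 ≺[ord] b.1) :
    WellFounded (fun a b => Rewrites B b a) := by
  refine Subrelation.wf ?_ (InvImage.wf ord.toSyn (wellFounded_lt (α := ord.syn)))
  rintro a a' ⟨b, hb, w, rfl, rfl⟩
  simpa [InvImage] using hB b hb

theorem join_of_eqvGen_rewrites {B : Set ((σ →₀ ℕ) × (σ →₀ ℕ))} (hB : ∀ b ∈ B, b.2 ≺[ord] b.1)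
    (hc : CritJoinable B) {a a' : σ →₀ ℕ} (h : Relation.EqvGen (Rewrites B) a a') :
    Relation.Join (Relation.ReflTransGen (Rewrites B)) a a' := by
  have hconf := Relation.join_of_wellFounded (wellFounded_rewrites ord hB)
    (fun _ _ _ h₁ h₂ => hc.join h₁ h₂)
  induction h with
  | rel a b h => exact ⟨b, .single h, .refl⟩
  | refl a => exact ⟨a, .refl, .refl⟩
  | symm a b _ ih =>
    obtain ⟨d, h1, h2⟩ := ih
    exact ⟨d, h2, h1⟩
  | trans a b c _ _ ih₁ ih₂ =>
    obtain ⟨d, h1, h2⟩ := ih₁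
    obtain ⟨e, h3, h4⟩ := ih₂
    obtain ⟨f, h5, h6⟩ := hconf b d e h2 h3
    exact ⟨f, h1.trans h5, h4.trans h6⟩

end Rewriting

/-! ### Binomials -/

section Binomial

variable {σ : Type*} (K : Type*) [Field K]

/-- The binomial `x ^ b.1 - x ^ b.2`. -/
noncomputable def binomial (b : (σ →₀ ℕ) × (σ →₀ ℕ)) : MvPolynomial σ K :=
  MvPolynomial.monomial b.1 1 - MvPolynomial.monomial b.2 1

theorem monomial_mul_binomial (u : σ →₀ ℕ) (b : (σ →₀ ℕ) × (σ →₀ ℕ)) :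
    MvPolynomial.monomial u 1 * binomial K b = binomial K (u + b.1, u + b.2) := by
  simp [binomial, mul_sub, MvPolynomial.monomial_mul]

theorem binomial_self (a : σ →₀ ℕ) : binomial K (a, a) = 0 := sub_self _

theorem neg_binomial (a b : σ →₀ ℕ) : -binomial K (a, b) = binomial K (b, a) := neg_sub _ _

theorem coeff_binomial_fst {a b : σ →₀ ℕ} (h : a ≠ b) : (binomial K (a, b)).coeff a = 1 := by
  classical
  simp [binomial, MvPolynomial.coeff_monomial, h.symm]

theorem coeff_binomial_snd {a b : σ →₀ ℕ} (h : a ≠ b) : (binomial K (a, b)).coeff b = -1 := by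
  classical
  simp [binomial, MvPolynomial.coeff_monomial, h]

theorem binomial_ne_zero {a b : σ →₀ ℕ} (h : a ≠ b) : binomial K (a, b) ≠ 0 := by
  intro h0
  have := coeff_binomial_fst K h
  simp [h0] at this

theorem mem_support_binomial {a b e : σ →₀ ℕ} (h : e ∈ (binomial K (a, b)).support) :
    e = a ∨ e = b := by
  classical
  by_contra! hne
  rw [MvPolynomial.mem_support_iff] at h
  exact h (by simp [binomial, MvPolynomial.coeff_monomial, hne.1.symm, hne.2.symm])

variable (ord : MonomialOrder σ)

theorem degree_binomial {a b : σ →₀ ℕ} (h : b ≺[ord] a) : ord.degree (binomial K (a, b)) = a := by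
  have hd : ord.degree (MvPolynomial.monomial b (1 : K)) ≺[ord]
      ord.degree (MvPolynomial.monomial a (1 : K)) := by
    classical
    simpa [ord.degree_monomial] using h
  rw [binomial, ord.degree_sub_of_lt hd]
  classical
  simp [ord.degree_monomial]

theorem ne_of_prec {a b : σ →₀ ℕ} (h : b ≺[ord] a) : a ≠ b := by
  rintro rfl
  exact lt_irrefl _ h

theorem degree_binomial_of_lt {a b : σ →₀ ℕ} (h : a ≺[ord] b) :
    ord.degree (binomial K (a, b)) = b := by
  rw [← neg_binomial, ord.degree_neg, degree_binomial K ord h]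

theorem leadingCoeff_binomial {a b : σ →₀ ℕ} (h : b ≺[ord] a) :
    ord.leadingCoeff (binomial K (a, b)) = 1 := by
  rw [MonomialOrder.leadingCoeff, degree_binomial K ord h,
    coeff_binomial_fst K (ne_of_prec ord h)]

theorem makeMonic_binomial {a b : σ →₀ ℕ} (h : b ≺[ord] a) :
    makeMonic ord (binomial K (a, b)) = binomial K (a, b) := by
  simp [makeMonic, leadingCoeff_binomial K ord h]

theorem makeMonic_binomial_of_lt {a b : σ →₀ ℕ} (h : a ≺[ord] b) :
    makeMonic ord (binomial K (a, b)) = binomial K (b, a) := by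
  have h1 : ord.leadingCoeff (binomial K (a, b)) = -1 := by
    rw [← neg_binomial, ord.leadingCoeff_neg, leadingCoeff_binomial K ord h]
  rw [makeMonic, h1, ← neg_binomial K a b, inv_neg, inv_one, map_neg, map_one, neg_one_mul]

/-- The sum of the coefficients over the exponents in `P`. -/
noncomputable def coeffSum (P : Set (σ →₀ ℕ)) : MvPolynomial σ K →ₗ[K] K :=
  (MvPolynomial.basisMonomials σ K).constr K (P.indicator 1)

variable {K}

theorem coeffSum_monomial (P : Set (σ →₀ ℕ)) (e : σ →₀ ℕ) (c : K) :
    coeffSum K P (MvPolynomial.monomial e c) = c * P.indicator 1 e := by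
  have h : MvPolynomial.monomial e c = c • MvPolynomial.basisMonomials σ K e := by
    simp [MvPolynomial.smul_monomial]
  rw [h, map_smul, coeffSum, Module.Basis.constr_basis, smul_eq_mul]

/-- The sum of the coefficients over a set of exponents vanishes on the ideal generated by
binomials that respect the set. -/
theorem coeffSum_eq_zero_of_mem_span {B : Set ((σ →₀ ℕ) × (σ →₀ ℕ))} {P : Set (σ →₀ ℕ)}
    (hP : ∀ b ∈ B, ∀ w, w + b.1 ∈ P ↔ w + b.2 ∈ P) {f : MvPolynomial σ K}
    (hf : f ∈ Ideal.span (binomial K '' B)) : coeffSum K P f = 0 := by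
  classical
  suffices h : ∀ r : MvPolynomial σ K, coeffSum K P (r * f) = 0 by simpa using h 1
  induction hf using Submodule.span_induction with
  | mem g hg =>
    obtain ⟨b, hb, rfl⟩ := hg
    intro r
    induction r using MvPolynomial.induction_on' with
    | monomial u c =>
      rw [binomial, mul_sub, map_sub, MvPolynomial.monomial_mul, MvPolynomial.monomial_mul,
        coeffSum_monomial, coeffSum_monomial]
      simp [Set.indicator_apply, hP b hb u]
    | add p q hp hq => rw [add_mul, map_add, hp, hq, add_zero]
  | zero => simp
  | add g h _ _ hg hh => intro r; rw [mul_add, map_add, hg, hh, add_zero]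
  | smul a g _ hg => intro r; rw [smul_eq_mul, ← mul_assoc]; exact hg _

/-- If all critical pairs are joinable, then an element of the ideal none of whose terms can be
reduced is zero. -/
theorem eq_zero_of_mem_span_of_irreducible {B : Set ((σ →₀ ℕ) × (σ →₀ ℕ))}
    (hB : ∀ b ∈ B, b.2 ≺[ord] b.1) (hc : CritJoinable B) {f : MvPolynomial σ K}
    (hf : f ∈ Ideal.span (binomial K '' B)) (hirr : ∀ e ∈ f.support, ∀ b ∈ B, ¬ b.1 ≤ e) :
    f = 0 := by
  classical
  have hno : ∀ e ∈ f.support, ∀ a, ¬ Rewrites B e a := by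
    rintro e he a ⟨b, hb, w, rfl, -⟩
    exact hirr _ he b hb le_add_self
  have hend : ∀ e ∈ f.support, ∀ a, Relation.ReflTransGen (Rewrites B) e a → a = e := by
    intro e he a h
    rcases h.cases_head with rfl | ⟨a', h, -⟩
    · rfl
    · exact absurd h (hno e he a')
  ext e
  rw [MvPolynomial.coeff_zero]
  by_contra he
  have he' : e ∈ f.support := MvPolynomial.mem_support_iff.2 he
  have h0 := coeffSum_eq_zero_of_mem_span (P := {a | Relation.EqvGen (Rewrites B) e a})
    (fun b hb w => by
      have h : Rewrites B (w + b.1) (w + b.2) := ⟨b, hb, w, rfl, rfl⟩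
      exact ⟨fun h' => h'.trans _ _ _ (.rel _ _ h),
        fun h' => h'.trans _ _ _ (.symm _ _ (.rel _ _ h))⟩) hf
  rw [f.as_sum, map_sum, Finset.sum_eq_single e] at h0
  · rw [coeffSum_monomial, Set.indicator_of_mem (show e ∈ {a | _} from .refl e)] at h0
    exact he (by simpa using h0)
  · intro a ha hae
    rw [coeffSum_monomial, Set.indicator_of_notMem, mul_zero]
    intro h
    obtain ⟨d, h1, h2⟩ := join_of_eqvGen_rewrites ord hB hc h
    exact hae ((hend a ha d h2).symm.trans (hend e he' d h1))
  · exact fun h => absurd he' h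

theorem sub_mem_span_of_reflTransGen {B : Set (MvPolynomial σ K)} {p q : MvPolynomial σ K}
    (h : Relation.ReflTransGen (ReducesTo ord B) p q) : p - q ∈ Ideal.span B := by
  induction h with
  | refl => simp
  | tail _ h ih =>
    obtain ⟨b, hb, -, e, -, -, rfl⟩ := h
    rw [← sub_add]
    exact add_mem ih (Ideal.mul_mem_left _ _ (Ideal.subset_span hb))

theorem not_le_of_irreducible {B : Set (MvPolynomial σ K)} {q : MvPolynomial σ K}
    (h : ∀ q', ¬ ReducesTo ord B q q') {b : MvPolynomial σ K} (hb : b ∈ B) (hb0 : b ≠ 0)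
    {e : σ →₀ ℕ} (he : e ∈ q.support) : ¬ ord.degree b ≤ e :=
  fun hle => h _ ⟨b, hb, hb0, e, he, hle, rfl⟩

/-- Normal forms with respect to binomials whose critical pairs are joinable are unique. -/
theorem normalForm_eq_of_isNormalForm {B : Set ((σ →₀ ℕ) × (σ →₀ ℕ))}
    (hB : ∀ b ∈ B, b.2 ≺[ord] b.1) (hc : CritJoinable B) {p q : MvPolynomial σ K}
    (h : IsNormalForm ord (binomial K '' B) p q) : normalForm ord (binomial K '' B) p = q := by
  classical
  have h' : IsNormalForm ord (binomial K '' B) p (normalForm ord (binomial K '' B) p) :=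
    Classical.epsilon_spec ⟨q, h⟩
  refine sub_eq_zero.1 (eq_zero_of_mem_span_of_irreducible ord hB hc ?_ ?_)
  · have := sub_mem (sub_mem_span_of_reflTransGen ord h.1) (sub_mem_span_of_reflTransGen ord h'.1)
    simpa using this
  · intro e he b hb hle
    have hd : ord.degree (binomial K b) = b.1 := degree_binomial K ord (hB b hb)
    have hb0 : binomial K b ≠ 0 := binomial_ne_zero K (ne_of_prec ord (hB b hb))
    rcases Finset.mem_union.1 (MvPolynomial.support_sub σ _ _ he) with he | he
    · exact not_le_of_irreducible ord h'.2 ⟨b, hb, rfl⟩ hb0 he (hd ▸ hle)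
    · exact not_le_of_irreducible ord h.2 ⟨b, hb, rfl⟩ hb0 he (hd ▸ hle)

theorem reducesTo_binomial_fst {B : Set ((σ →₀ ℕ) × (σ →₀ ℕ))} {b : (σ →₀ ℕ) × (σ →₀ ℕ)}
    (hb : b ∈ B) (hlt : b.2 ≺[ord] b.1) {a c : σ →₀ ℕ} (hne : a ≠ c) (hle : b.1 ≤ a) :
    ReducesTo ord (binomial K '' B) (binomial K (a, c)) (binomial K (a - b.1 + b.2, c)) := by
  refine ⟨_, ⟨b, hb, rfl⟩, binomial_ne_zero K (ne_of_prec ord hlt), a, ?_, ?_, ?_⟩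
  · simp [MvPolynomial.mem_support_iff, coeff_binomial_fst K hne]
  · rwa [degree_binomial K ord hlt]
  · rw [degree_binomial K ord hlt, leadingCoeff_binomial K ord hlt, coeff_binomial_fst K hne,
      div_one, monomial_mul_binomial, tsub_add_cancel_of_le hle]
    simp only [binomial]
    ring

theorem reducesTo_binomial_snd {B : Set ((σ →₀ ℕ) × (σ →₀ ℕ))} {b : (σ →₀ ℕ) × (σ →₀ ℕ)}
    (hb : b ∈ B) (hlt : b.2 ≺[ord] b.1) {a c : σ →₀ ℕ} (hne : c ≠ a) (hle : b.1 ≤ a) :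
    ReducesTo ord (binomial K '' B) (binomial K (c, a)) (binomial K (c, a - b.1 + b.2)) := by
  refine ⟨_, ⟨b, hb, rfl⟩, binomial_ne_zero K (ne_of_prec ord hlt), a, ?_, ?_, ?_⟩
  · simp [MvPolynomial.mem_support_iff, coeff_binomial_snd K hne]
  · rwa [degree_binomial K ord hlt]
  · rw [degree_binomial K ord hlt, leadingCoeff_binomial K ord hlt, coeff_binomial_snd K hne,
      div_one, map_neg, neg_mul, monomial_mul_binomial, tsub_add_cancel_of_le hle]
    simp only [binomial]
    ring

theorem not_reducesTo_binomial {B : Set ((σ →₀ ℕ) × (σ →₀ ℕ))} (hB : ∀ b ∈ B, b.2 ≺[ord] b.1)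
    {a c : σ →₀ ℕ} (h : a = c ∨ ∀ b ∈ B, ¬ b.1 ≤ a ∧ ¬ b.1 ≤ c) (q : MvPolynomial σ K) :
    ¬ ReducesTo ord (binomial K '' B) (binomial K (a, c)) q := by
  rintro ⟨_, ⟨b, hb, rfl⟩, -, e, he, hle, -⟩
  rw [degree_binomial K ord (hB b hb)] at hle
  rcases h with rfl | h
  · simp [binomial_self] at he
  · rcases mem_support_binomial K he with rfl | rfl
    · exact (h b hb).1 hle
    · exact (h b hb).2 hle

/-- `p` is a combination of elements of `G` all of whose summands have a head term of at most
`e`. -/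
def HasRepUpTo (G : Set (MvPolynomial σ K)) (e : σ →₀ ℕ) (p : MvPolynomial σ K) : Prop :=
  ∃ (k : ℕ) (c q : Fin k → MvPolynomial σ K),
    (∀ i, q i ∈ G) ∧ p = ∑ i, c i * q i ∧ ∀ i, c i * q i ≠ 0 → ord.degree (c i * q i) ≼[ord] e

theorem HasRepUpTo.zero (G : Set (MvPolynomial σ K)) (e : σ →₀ ℕ) : HasRepUpTo ord G e 0 :=
  ⟨0, Fin.elim0, Fin.elim0, fun i => i.elim0, by simp, fun i => i.elim0⟩

theorem HasRepUpTo.add_mul {G : Set (MvPolynomial σ K)} {e : σ →₀ ℕ} {p : MvPolynomial σ K}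
    (h : HasRepUpTo ord G e p) {c g : MvPolynomial σ K} (hg : g ∈ G)
    (hcg : ord.degree (c * g) ≼[ord] e) : HasRepUpTo ord G e (c * g + p) := by
  obtain ⟨k, d, q, hq, rfl, hd⟩ := h
  refine ⟨k + 1, Fin.cons c d, Fin.cons g q, ?_, ?_, ?_⟩
  · exact Fin.cases hg hq
  · simp [Fin.sum_univ_succ]
  · exact Fin.cases (fun _ => hcg) hd

theorem HasRepUpTo.neg {G : Set (MvPolynomial σ K)} {e : σ →₀ ℕ} {p : MvPolynomial σ K}
    (h : HasRepUpTo ord G e p) : HasRepUpTo ord G e (-p) := by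
  obtain ⟨k, d, q, hq, rfl, hd⟩ := h
  refine ⟨k, -d, q, hq, by simp, fun i hi => ?_⟩
  simp only [Pi.neg_apply, neg_mul, ord.degree_neg] at hi ⊢
  exact hd i (by simpa using hi)

theorem HasRepUpTo.binomial_of_rewrite {B : Set ((σ →₀ ℕ) × (σ →₀ ℕ))}
    {b : (σ →₀ ℕ) × (σ →₀ ℕ)} (hb : b ∈ B) (hlt : b.2 ≺[ord] b.1) {a c e : σ →₀ ℕ}
    (hae : a ≼[ord] e) (hle : b.1 ≤ a)
    (h : HasRepUpTo ord (binomial K '' B) e (binomial K (a - b.1 + b.2, c))) :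
    HasRepUpTo ord (binomial K '' B) e (binomial K (a, c)) := by
  have hmul : MvPolynomial.monomial (a - b.1) (1 : K) * binomial K b
      = binomial K (a, a - b.1 + b.2) := by
    rw [monomial_mul_binomial, tsub_add_cancel_of_le hle]
  have hlt' : a - b.1 + b.2 ≺[ord] a := by
    conv_rhs => rw [← tsub_add_cancel_of_le hle]
    simpa using hlt
  have := h.add_mul ord (c := MvPolynomial.monomial (a - b.1) 1) ⟨b, hb, rfl⟩
    (by rw [hmul, degree_binomial K ord hlt']; exact hae)
  rw [hmul] at this
  convert this using 1
  simp only [binomial]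
  ring

end Binomial

/-! ### An executable model of F5 for pure difference binomials in four variables -/

namespace BinomialF5

/-- Exponent vectors in four variables. -/
abbrev Expo := ℕ × ℕ × ℕ × ℕ

/-- The exponent vector as a finitely supported function. -/
noncomputable def toF (a : Expo) : Fin 4 →₀ ℕ :=
  Finsupp.equivFunOnFinite.symm ![a.1, a.2.1, a.2.2.1, a.2.2.2]

theorem toF_apply_zero (a : Expo) : toF a 0 = a.1 := rfl
theorem toF_apply_one (a : Expo) : toF a 1 = a.2.1 := rfl
theorem toF_apply_two (a : Expo) : toF a 2 = a.2.2.1 := rfl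
theorem toF_apply_three (a : Expo) : toF a 3 = a.2.2.2 := rfl

theorem toF_injective : Function.Injective toF := by
  intro a b h
  have h' : ∀ i, toF a i = toF b i := fun i => by rw [h]
  exact Prod.ext (h' 0) (Prod.ext (h' 1) (Prod.ext (h' 2) (h' 3)))

@[simp] theorem toF_inj {a b : Expo} : toF a = toF b ↔ a = b := toF_injective.eq_iff

theorem toF_zero : toF 0 = 0 := by
  ext i; fin_cases i <;> rfl

theorem toF_add (a b : Expo) : toF (a + b) = toF a + toF b := by
  ext i; fin_cases i <;> rfl

theorem toF_sub (a b : Expo) : toF (a - b) = toF a - toF b := by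
  ext i; fin_cases i <;> rfl

theorem toF_sup (a b : Expo) : toF (a ⊔ b) = toF a ⊔ toF b := by
  ext i; fin_cases i <;> rfl

@[simp] theorem toF_le {a b : Expo} : toF a ≤ toF b ↔ a ≤ b := by
  constructor
  · intro h
    exact ⟨h 0, h 1, h 2, h 3⟩
  · rintro ⟨h0, h1, h2, h3⟩ i
    fin_cases i
    exacts [h0, h1, h2, h3]

/-- The degree of an exponent vector. -/
def deg (a : Expo) : ℕ := a.1 + a.2.1 + a.2.2.1 + a.2.2.2

@[simp] theorem degree_toF (a : Expo) : (toF a).degree = deg a := by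
  rw [Finsupp.degree_eq_sum, Fin.sum_univ_four]
  rfl

/-- The degree reverse lexicographical ordering. -/
def prec (a b : Expo) : Bool :=
  deg a < deg b || deg a == deg b &&
    (b.2.2.2 < a.2.2.2 || a.2.2.2 == b.2.2.2 &&
      (b.2.2.1 < a.2.2.1 || a.2.2.1 == b.2.2.1 &&
        (b.2.1 < a.2.1 || a.2.1 == b.2.1 && decide (b.1 < a.1))))

@[simp] theorem toF_prec_iff {a b : Expo} : toF a ≺[degRevLex 4] toF b ↔ prec a b = true := by
  have key : (∃ i, (∀ j, i < j → toF a j = toF b j) ∧ toF b i < toF a i) ↔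
      (b.2.2.2 < a.2.2.2 ∨ a.2.2.2 = b.2.2.2 ∧
        (b.2.2.1 < a.2.2.1 ∨ a.2.2.1 = b.2.2.1 ∧
          (b.2.1 < a.2.1 ∨ a.2.1 = b.2.1 ∧ b.1 < a.1))) := by
    simp only [← toF_apply_zero, ← toF_apply_one, ← toF_apply_two, ← toF_apply_three]
    constructor
    · rintro ⟨i, h, h'⟩
      fin_cases i
      · exact .inr ⟨h 3 (by decide), .inr ⟨h 2 (by decide), .inr ⟨h 1 (by decide), h'⟩⟩⟩
      · exact .inr ⟨h 3 (by decide), .inr ⟨h 2 (by decide), .inl h'⟩⟩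
      · exact .inr ⟨h 3 (by decide), .inl h'⟩
      · exact .inl h'
    · rintro (h | ⟨h3, h | ⟨h2, h | ⟨h1, h⟩⟩⟩)
      · exact ⟨3, fun j hj => by fin_cases j <;> simp at hj, h⟩
      · exact ⟨2, fun j hj => by fin_cases j <;> simp_all [Fin.lt_def], h⟩
      · exact ⟨1, fun j hj => by fin_cases j <;> simp_all [Fin.lt_def], h⟩
      · exact ⟨0, fun j hj => by fin_cases j <;> simp_all [Fin.lt_def], h⟩
  rw [degRevLex_lt_iff, key]
  simp only [degree_toF, prec, Bool.or_eq_true, Bool.and_eq_true, decide_eq_true_eq, beq_iff_eq]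

/-! #### Binomials -/

section Binomials

/-- A pair of exponent vectors stands for the binomial `x ^ p.1 - x ^ p.2`. -/
abbrev Bin := Expo × Expo

/-- The pair of finitely supported functions. -/
noncomputable def toFF (p : Bin) : (Fin 4 →₀ ℕ) × (Fin 4 →₀ ℕ) := (toF p.1, toF p.2)

/-- The exponent of the head term. -/
def headExp (p : Bin) : Expo := if p.1 = p.2 then 0 else if prec p.1 p.2 then p.2 else p.1

/-- The monic multiple of a binomial. -/
def monic (p : Bin) : Bin := if prec p.1 p.2 then p.swap else p

theorem prec_total {a b : Expo} (hne : a ≠ b) (h : ¬ prec a b = true) : prec b a = true := by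
  rw [← toF_prec_iff] at h ⊢
  exact lt_of_le_of_ne (not_lt.1 h) (by simpa using hne.symm)

theorem degree_binomial_toFF (K : Type*) [Field K] (p : Bin) :
    (degRevLex 4).degree (binomial K (toFF p)) = toF (headExp p) := by
  obtain ⟨a, b⟩ := p
  simp only [headExp, toFF]
  split_ifs with h1 h2
  · subst h1
    rw [binomial_self, MonomialOrder.degree_zero, toF_zero]
  · exact degree_binomial_of_lt K _ (toF_prec_iff.2 h2)
  · exact degree_binomial K _ (toF_prec_iff.2 (prec_total h1 h2))

theorem makeMonic_binomial_toFF (K : Type*) [Field K] {p : Bin} (hp : p.1 ≠ p.2) :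
    makeMonic (degRevLex 4) (binomial K (toFF p)) = binomial K (toFF (monic p)) := by
  obtain ⟨a, b⟩ := p
  simp only [monic, toFF]
  split_ifs with h
  · exact makeMonic_binomial_of_lt K _ (toF_prec_iff.2 h)
  · exact makeMonic_binomial K _ (toF_prec_iff.2 (prec_total hp h))

theorem binomial_toFF_eq_zero_iff (K : Type*) [Field K] {p : Bin} :
    binomial K (toFF p) = 0 ↔ p.1 = p.2 := by
  constructor
  · intro h
    by_contra hne
    exact binomial_ne_zero K (mt toF_inj.1 hne) h
  · rintro h
    rw [toFF, h, binomial_self]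

/-- Reduction of a binomial by the first element of `B` that applies, at most `n` times. -/
def reduceBin (B : List Bin) : ℕ → Bin → Bin
  | 0, p => p
  | n + 1, p =>
    if p.1 = p.2 then p
    else
      match B.find? (fun b => b.1 ≤ p.1) with
      | some b => reduceBin B n (p.1 - b.1 + b.2, p.2)
      | none =>
        match B.find? (fun b => b.1 ≤ p.2) with
        | some b => reduceBin B n (p.1, p.2 - b.1 + b.2)
        | none => p

/-- `p` is zero or irreducible modulo `B`. -/
def isNormal (B : List Bin) (p : Bin) : Bool :=
  p.1 = p.2 || B.all fun b => !decide (b.1 ≤ p.1) && !decide (b.1 ≤ p.2)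

/-- The bound for the number of reduction steps. -/
abbrev fuel : ℕ := 20

/-- The two terms that remain in the s-polynomial of `b` and `c`. -/
def critBin (b c : Bin) : Bin := (b.1 ⊔ c.1 - b.1 + b.2, b.1 ⊔ c.1 - c.1 + c.2)

/-- The elements of `B` are monic and all their s-polynomials reduce to zero. -/
def isGroebner (B : List Bin) : Bool :=
  B.all fun b => prec b.2 b.1 && B.all fun c =>
    let q := reduceBin B fuel (critBin b c)
    q.1 = q.2

/-- The binomials of a list, as a set. -/
def binSet (B : List Bin) : Set ((Fin 4 →₀ ℕ) × (Fin 4 →₀ ℕ)) := {q | ∃ b ∈ B, toFF b = q}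

theorem toFF_mem_binSet {B : List Bin} {b : Bin} (hb : b ∈ B) : toFF b ∈ binSet B := ⟨b, hb, rfl⟩

theorem rewrites_toF {B : List Bin} {b : Bin} (hb : b ∈ B) {a : Expo} (h : b.1 ≤ a) :
    Rewrites (binSet B) (toF a) (toF (a - b.1 + b.2)) :=
  ⟨toFF b, ⟨b, hb, rfl⟩, toF (a - b.1),
    by rw [toFF, ← toF_add, tsub_add_cancel_of_le h], by rw [toF_add, toFF]⟩

theorem reflTransGen_reduceBin (B : List Bin) (n : ℕ) (p : Bin) :
    Relation.ReflTransGen (Rewrites (binSet B)) (toF p.1) (toF (reduceBin B n p).1) ∧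
      Relation.ReflTransGen (Rewrites (binSet B)) (toF p.2) (toF (reduceBin B n p).2) := by
  induction n generalizing p with
  | zero => exact ⟨.refl, .refl⟩
  | succ n ih =>
    rw [reduceBin]
    split_ifs with h
    · exact ⟨.refl, .refl⟩
    split
    · rename_i b hb
      have hle : b.1 ≤ p.1 := by simpa using List.find?_some hb
      obtain ⟨h1, h2⟩ := ih (p.1 - b.1 + b.2, p.2)
      exact ⟨.head (rewrites_toF (List.mem_of_find?_eq_some hb) hle) h1, h2⟩
    · split
      · rename_i b hb
        have hle : b.1 ≤ p.2 := by simpa using List.find?_some hb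
        obtain ⟨h1, h2⟩ := ih (p.1, p.2 - b.1 + b.2)
        exact ⟨h1, .head (rewrites_toF (List.mem_of_find?_eq_some hb) hle) h2⟩
      · exact ⟨.refl, .refl⟩

theorem prec_of_mem_binSet {B : List Bin} (hB : ∀ b ∈ B, prec b.2 b.1 = true) :
    ∀ b ∈ binSet B, b.2 ≺[degRevLex 4] b.1 := by
  rintro _ ⟨b, hb, rfl⟩
  exact toF_prec_iff.2 (hB b hb)

theorem prec_of_isGroebner {B : List Bin} (h : isGroebner B = true) :
    ∀ b ∈ B, prec b.2 b.1 = true := by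
  simp only [isGroebner, List.all_eq_true, Bool.and_eq_true] at h
  exact fun b hb => (h b hb).1

theorem critJoinable_of_isGroebner {B : List Bin} (h : isGroebner B = true) :
    CritJoinable (binSet B) := by
  simp only [isGroebner, List.all_eq_true, Bool.and_eq_true, decide_eq_true_eq] at h
  rintro _ ⟨b, hb, rfl⟩ _ ⟨c, hc, rfl⟩
  obtain ⟨h1, h2⟩ := reflTransGen_reduceBin B fuel (critBin b c)
  rw [← (h b hb).2 c hc] at h2
  simp only [toFF, ← toF_sup, ← toF_sub, ← toF_add]
  exact ⟨_, h1, h2⟩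

theorem reflTransGen_reducesTo_reduceBin (K : Type*) [Field K] {B : List Bin}
    (hB : ∀ b ∈ B, prec b.2 b.1 = true) (n : ℕ) (p : Bin) :
    Relation.ReflTransGen (ReducesTo (degRevLex 4) (binomial K '' binSet B))
      (binomial K (toFF p)) (binomial K (toFF (reduceBin B n p))) := by
  induction n generalizing p with
  | zero => exact .refl
  | succ n ih =>
    rw [reduceBin]
    split_ifs with h
    · exact .refl
    have h' : toF p.1 ≠ toF p.2 := mt toF_inj.1 h
    split
    · rename_i b hb
      have hle : b.1 ≤ p.1 := by simpa using List.find?_some hb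
      have hmem := List.mem_of_find?_eq_some hb
      refine .head ?_ (ih (p.1 - b.1 + b.2, p.2))
      simp only [toFF, toF_add, toF_sub]
      exact reducesTo_binomial_fst (degRevLex 4) (b := toFF b) (toFF_mem_binSet hmem)
        (toF_prec_iff.2 (hB b hmem)) h' (toF_le.2 hle)
    · split
      · rename_i b hb
        have hle : b.1 ≤ p.2 := by simpa using List.find?_some hb
        have hmem := List.mem_of_find?_eq_some hb
        refine .head ?_ (ih (p.1, p.2 - b.1 + b.2))
        simp only [toFF, toF_add, toF_sub]
        exact reducesTo_binomial_snd (degRevLex 4) (b := toFF b) (toFF_mem_binSet hmem)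
          (toF_prec_iff.2 (hB b hmem)) h' (toF_le.2 hle)
      · exact .refl

theorem normalForm_binomial (K : Type*) [Field K] {B : List Bin} (hB : isGroebner B = true)
    {p : Bin} (hp : isNormal B (reduceBin B fuel p) = true) :
    normalForm (degRevLex 4) (binomial K '' binSet B) (binomial K (toFF p)) =
      binomial K (toFF (reduceBin B fuel p)) := by
  have hlt := prec_of_isGroebner hB
  refine normalForm_eq_of_isNormalForm _ (prec_of_mem_binSet hlt) (critJoinable_of_isGroebner hB)
    ⟨reflTransGen_reducesTo_reduceBin K hlt fuel p,
      not_reducesTo_binomial _ (prec_of_mem_binSet hlt) ?_⟩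
  simp only [isNormal, Bool.or_eq_true, decide_eq_true_eq, List.all_eq_true, Bool.and_eq_true,
    Bool.not_eq_true', decide_eq_false_iff_not] at hp
  refine hp.imp (fun h => by rw [h]) ?_
  rintro h _ ⟨b, hb, rfl⟩
  exact ⟨mt toF_le.1 (h b hb).1, mt toF_le.1 (h b hb).2⟩

theorem hasRepUpTo_of_reduceBin (K : Type*) [Field K] {B : List Bin}
    (hB : ∀ b ∈ B, prec b.2 b.1 = true) (n : ℕ) (p : Bin) {e : Fin 4 →₀ ℕ}
    (h : (reduceBin B n p).1 = (reduceBin B n p).2)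
    (h1 : toF p.1 ≼[degRevLex 4] e) (h2 : toF p.2 ≼[degRevLex 4] e) :
    HasRepUpTo (degRevLex 4) (binomial K '' binSet B) e (binomial K (toFF p)) := by
  have hle' : ∀ b ∈ B, ∀ a : Expo, b.1 ≤ a → toF a ≼[degRevLex 4] e →
      toF (a - b.1 + b.2) ≼[degRevLex 4] e := by
    intro b hb a hle ha
    refine le_trans (le_of_lt ?_) ha
    conv_rhs => rw [← tsub_add_cancel_of_le hle]
    rw [toF_add, toF_add, map_add, map_add]
    exact add_lt_add_right (toF_prec_iff.2 (hB b hb)) _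
  induction n generalizing p with
  | zero =>
    rw [reduceBin] at h
    rw [toFF, h, binomial_self]
    exact .zero _ _ _
  | succ n ih =>
    rw [reduceBin] at h
    split_ifs at h with h0
    · rw [toFF, h0, binomial_self]
      exact .zero _ _ _
    split at h
    · rename_i b hb
      have hle : b.1 ≤ p.1 := by simpa using List.find?_some hb
      have hmem := List.mem_of_find?_eq_some hb
      refine .binomial_of_rewrite (degRevLex 4) (b := toFF b) (toFF_mem_binSet hmem)
        (toF_prec_iff.2 (hB b hmem)) h1 (toF_le.2 hle) ?_
      have := ih _ h (hle' b hmem _ hle h1) h2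
      simpa only [toFF, toF_add, toF_sub] using this
    · split at h
      · rename_i b hb
        have hle : b.1 ≤ p.2 := by simpa using List.find?_some hb
        have hmem := List.mem_of_find?_eq_some hb
        rw [toFF, ← neg_binomial]
        refine HasRepUpTo.neg _ (.binomial_of_rewrite (degRevLex 4) (b := toFF b) (toFF_mem_binSet hmem)
          (toF_prec_iff.2 (hB b hmem)) h2 (toF_le.2 hle) ?_)
        have := (ih _ h h1 (hle' b hmem _ hle h2)).neg
        simpa only [toFF, toF_add, toF_sub, neg_binomial] using this
      · exact absurd h h0

/-- The elements of `B` are monic and all their s-polynomials of degree at most `d` reduce to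
zero. -/
def isGroebnerUpTo (d : ℕ) (B : List Bin) : Bool :=
  B.all fun b => prec b.2 b.1 && B.all fun c =>
    let q := critBin b c
    d < deg q.1 || (reduceBin B fuel q).1 = (reduceBin B fuel q).2

theorem sPolynomial_binomial (K : Type*) [Field K] {b c : Bin} (hb : prec b.2 b.1 = true)
    (hc : prec c.2 c.1 = true) :
    (degRevLex 4).sPolynomial (binomial K (toFF b)) (binomial K (toFF c)) =
      -binomial K (toFF (critBin b c)) := by
  rw [← toF_prec_iff] at hb hc
  rw [MonomialOrder.sPolynomial_def, toFF, toFF, leadingCoeff_binomial K _ hb,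
    leadingCoeff_binomial K _ hc, degree_binomial K _ hb, degree_binomial K _ hc,
    monomial_mul_binomial, monomial_mul_binomial,
    tsub_add_cancel_of_le (le_sup_left (a := toF b.1)),
    tsub_add_cancel_of_le (le_sup_right (a := toF b.1))]
  simp only [toFF, critBin, toF_add, toF_sub, toF_sup, binomial]
  ring

theorem hasStdRep_sPolynomial (K : Type*) [Field K] {d : ℕ} {B : List Bin}
    (hB : isGroebnerUpTo d B = true) :
    ∀ p ∈ binomial K '' binSet B, ∀ q ∈ binomial K '' binSet B,
      ((degRevLex 4).sPolynomial p q).totalDegree ≤ d →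
        HasStdRep (degRevLex 4) (binomial K '' binSet B) ((degRevLex 4).sPolynomial p q) := by
  simp only [isGroebnerUpTo, List.all_eq_true, Bool.and_eq_true, Bool.or_eq_true,
    decide_eq_true_eq] at hB
  rintro _ ⟨_, ⟨b, hb, rfl⟩, rfl⟩ _ ⟨_, ⟨c, hc, rfl⟩, rfl⟩ hd
  rw [sPolynomial_binomial K (hB b hb).1 (hB c hc).1] at hd ⊢
  by_cases h0 : (critBin b c).1 = (critBin b c).2
  · exact .inl (by rw [toFF, h0, binomial_self, neg_zero])
  refine .inr ((hasRepUpTo_of_reduceBin K (fun b hb => (hB b hb).1) fuel (critBin b c) ?_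
    ?_ ?_).neg)
  · refine ((hB b hb).2 c hc).resolve_left (not_lt.2 (le_trans ?_ hd))
    rw [MvPolynomial.totalDegree_neg, ← degree_toF]
    refine le_trans (le_of_eq ?_) (MvPolynomial.le_totalDegree (s := toF (critBin b c).1) ?_)
    · rw [Finsupp.degree_eq_sum, Finsupp.sum_fintype _ _ (by simp)]
    · rw [MvPolynomial.mem_support_iff, toFF, coeff_binomial_fst K (mt toF_inj.1 h0)]
      exact one_ne_zero
  · rw [MonomialOrder.degree_neg]
    refine MonomialOrder.le_degree ?_
    rw [MvPolynomial.mem_support_iff, toFF, coeff_binomial_fst K (mt toF_inj.1 h0)]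
    exact one_ne_zero
  · rw [MonomialOrder.degree_neg]
    refine MonomialOrder.le_degree ?_
    rw [MvPolynomial.mem_support_iff, toFF, coeff_binomial_snd K (mt toF_inj.1 h0)]
    exact neg_ne_zero.2 one_ne_zero

end Binomials

/-! #### Labeled binomials -/

/-- A signature: its term and its index. -/
abbrev Sig := Expo × Fin 3

/-- The ordering of signatures. -/
def sigLt (s t : Sig) : Bool := decide (t.2 < s.2) || s.2 == t.2 && prec s.1 t.1

/-- The signature multiplied by a term. -/
def shift (u : Expo) (s : Sig) : Sig := (u + s.1, s.2)

/-- A labeled binomial. -/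
structure Lab where
  num : ℕ
  sig : Sig
  bin : Bin

/-- The exponent of the head term of a labeled binomial. -/
def Lab.head (r : Lab) : Expo := headExp r.bin

/-- The list of rules. -/
abbrev RuleList := List (Sig × ℕ)

/-- Faugère's Criterion. -/
def faugere (G : List Lab) (u : Expo) (r : Lab) : Bool :=
  G.any fun g => decide (r.sig.2 < g.sig.2) && decide (g.head ≤ u + r.sig.1)

/-- The Rewritten Criterion. -/
def rewritten (rules : RuleList) (u : Expo) (r : Lab) : Bool :=
  rules.any fun a => a.1.2 == r.sig.2 && decide (r.num < a.2) && decide (a.1.1 ≤ u + r.sig.1)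

/-- A critical pair of labeled binomials. -/
structure Pair where
  lcm : Expo
  u₁ : Expo
  r₁ : Lab
  u₂ : Expo
  r₂ : Lab

/-- The critical pair of `r` and `s`, without any test. -/
def orient (r s : Lab) : Pair :=
  let t := r.head ⊔ s.head
  let u := t - r.head
  let v := t - s.head
  if sigLt (shift u r.sig) (shift v s.sig) then ⟨t, v, s, u, r⟩ else ⟨t, u, r, v, s⟩

/-- The critical pair of `r` and `s`, unless it is rejected by Faugère's Criterion. -/
def crit (i : Fin 3) (G : List Lab) (r s : Lab) : Option Pair :=
  let p := orient r s
  if i < p.r₁.sig.2 then none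
  else if faugere G p.u₁ p.r₁ then none
  else if p.r₂.sig.2 = i ∧ faugere G p.u₂ p.r₂ = true then none
  else some p

/-- Insertion into a list sorted by signature. -/
def insertSig (r : Lab) (l : List Lab) : List Lab :=
  l.orderedInsert (fun a b => a.sig = b.sig ∨ sigLt a.sig b.sig = true) r

/-- The outcome of `Spol`: the labeled binomials to be reduced, the counter and the rules. -/
structure SpolState where
  todo : List Lab
  count : ℕ
  rules : RuleList

/-- `Spol`; the value is `none` if the head terms of some pair do not cancel. -/
def spol : List Pair → SpolState → Option SpolState
  | [], s => some s
  | p :: ps, s =>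
    if rewritten s.rules p.u₁ p.r₁ || rewritten s.rules p.u₂ p.r₂ then spol ps s
    else if p.u₁ + p.r₁.bin.1 = p.u₂ + p.r₂.bin.1 then
      let r : Lab := ⟨s.count, shift p.u₁ p.r₁.sig, (p.u₂ + p.r₂.bin.2, p.u₁ + p.r₁.bin.2)⟩
      spol ps ⟨insertSig r s.todo, s.count + 1, (r.sig, r.num) :: s.rules⟩
    else none

/-- The admissible reducers. -/
def isReducer (i : Fin 3) (G : List Lab) (rules : RuleList) (r g : Lab) : Bool :=
  g.sig.2 == i && decide (g.head ≤ r.head) && !faugere G (r.head - g.head) g &&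
    !rewritten rules (r.head - g.head) g && !(shift (r.head - g.head) g.sig == r.sig)

/-- The binomials of index greater than `i`. -/
def binsAbove (i : Fin 3) (G : List Lab) : List Bin :=
  (G.filter fun g => i < g.sig.2).map Lab.bin

/-- `Reduction`, for the case that no labeled binomial is reduced to zero and that there is never
an admissible reducer; otherwise the value is `none`. -/
def reduceAll (i : Fin 3) (G : List Lab) (rules : RuleList) :
    List Lab → List Lab → Option (List Lab)
  | [], done => some done
  | r :: rest, done =>
    let B := binsAbove i G
    let p := reduceBin B fuel r.bin
    if isGroebner B && isNormal B p && !(p.1 == p.2) &&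
        !(G ++ done).any (isReducer i (G ++ done) rules { r with bin := p }) then
      reduceAll i G rules rest (done ++ [{ r with bin := monic p }])
    else none

/-- The state between two degree steps. -/
structure MState where
  cur : Fin 3
  G : List Lab
  pairs : List Pair
  count : ℕ
  rules : RuleList

/-- The state after a call of `Reduction`. -/
structure MRed where
  done : List Lab
  count : ℕ
  rules : RuleList

/-- The smallest degree of a critical pair that is left. -/
def MState.nextDegree (s : MState) : Option ℕ := (s.pairs.map fun p => deg p.lcm).min?

/-- The critical pairs of degree `d`. -/
def MState.pairsOfDegree (d : ℕ) (s : MState) : List Pair := s.pairs.filter fun p => deg p.lcm = d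

/-- `Spol` and `Reduction` for the critical pairs in `l`. -/
def MState.reduceDegree (l : List Pair) (s : MState) : Option MRed :=
  match spol l ⟨[], s.count, s.rules⟩ with
  | none => none
  | some t =>
    match reduceAll s.cur s.G t.rules t.todo [] with
    | none => none
    | some done => some ⟨done, t.count, t.rules⟩

/-- Add `r` to `G`, after forming its critical pairs. -/
def MState.addLab (s : MState) (r : Lab) : MState :=
  { s with
    pairs := s.pairs ++ s.G.filterMap (crit s.cur s.G r)
    G := s.G ++ [r] }

/-- The effect of the degree step `d`. -/
def MState.finishDegree (d : ℕ) (s : MState) (t : MRed) : MState :=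
  t.done.foldl MState.addLab
    { s with
      pairs := s.pairs.filter fun p => deg p.lcm ≠ d
      count := t.count
      rules := t.rules }

/-- The input. -/
def inputBin : Fin 3 → Bin :=
  ![((0, 1, 3, 0), (2, 0, 0, 2)), ((1, 0, 2, 0), (0, 2, 0, 1)), ((2, 1, 0, 0), (0, 0, 2, 1))]

/-- The labeled input. -/
def inputLab (i : Fin 3) : Lab := ⟨i, (0, i), inputBin i⟩

/-- The start. -/
def MState.init : MState := ⟨2, [inputLab 2], [], 3, []⟩

/-- The beginning of iteration `i`. -/
def MState.startIteration (i : Fin 3) (s : MState) : MState :=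
  { s with
    cur := i
    G := s.G ++ [inputLab i]
    pairs := s.G.filterMap (crit i s.G (inputLab i)) }

/-- All states that can be reached in `n` steps from `s` satisfy `check`, in whatever order
critical pairs of equal degree are treated. -/
def allRuns (check : MState → Bool) : ℕ → MState → Bool
  | 0, s => check s
  | n + 1, s =>
    match s.nextDegree with
    | some d =>
      (s.pairsOfDegree d).permutations'.all fun l =>
        match s.reduceDegree l with
        | none => false
        | some t => allRuns check n (s.finishDegree d t)
    | none => !(s.cur == 0) && allRuns check n (s.startIteration (s.cur - 1))

/-- The basis before the last degree step. -/
def finalBasis : List Bin :=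
  [((2, 1, 0, 0), (0, 0, 2, 1)), ((1, 0, 2, 0), (0, 2, 0, 1)), ((1, 3, 0, 1), (0, 0, 4, 1)),
   ((0, 0, 6, 1), (0, 5, 0, 2)), ((0, 1, 3, 0), (2, 0, 0, 2)), ((0, 3, 1, 1), (3, 0, 0, 2)),
   ((0, 0, 5, 1), (4, 0, 0, 2)), ((0, 5, 0, 2), (4, 0, 1, 2)), ((5, 0, 0, 2), (0, 2, 3, 2))]

/-- The required properties of the state before degree `8` and of the result of that degree. -/
def finalCheck (s : MState) : Bool :=
  s.cur == 0 && s.nextDegree == some 8 && s.G.map Lab.bin == finalBasis &&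
    (s.pairsOfDegree 8).permutations'.all fun l =>
      match s.reduceDegree l with
      | none => false
      | some t => !t.done.isEmpty && t.done.all fun r => s.G.any fun g => decide (g.head ≤ r.head)

theorem allRuns_finalCheck : allRuns finalCheck 7 MState.init = true := by
  decide +kernel

theorem isGroebnerUpTo_finalBasis : isGroebnerUpTo 7 finalBasis = true := by
  decide +kernel

/-! #### Correctness of the model -/

section Correctness

variable (K : Type*) [Field K]

/-- The signature that is modelled by `s`. -/
noncomputable def toSig (s : Sig) : F5.Signature (Fin 4) 2 := ⟨toF s.1, s.2⟩

theorem toSig_injective : Function.Injective toSig := by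
  intro s t h
  exact Prod.ext (toF_injective (congrArg F5.Signature.term h)) (congrArg F5.Signature.idx h)

theorem lt_toSig_iff (s t : Sig) :
    (toSig s).Lt (degRevLex 4) (toSig t) ↔ sigLt s t = true := by
  simp [F5.Signature.Lt, toSig, sigLt]

theorem shift_toSig (u : Expo) (s : Sig) : (toSig s).shift (toF u) = toSig (shift u s) := by
  simp [F5.Signature.shift, toSig, shift, toF_add]

/-- The labeled polynomial that is modelled by `r`. -/
noncomputable def Lab.toPoly (r : Lab) : F5.LabeledPoly (Fin 4) K 2 :=
  ⟨r.num, toSig r.sig, binomial K (toFF r.bin)⟩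

theorem ht_toPoly (r : Lab) : (r.toPoly K).ht (degRevLex 4) = toF r.head :=
  degree_binomial_toFF K r.bin

/-- The list of labeled polynomials that is modelled by `G`. -/
noncomputable def toPolys (G : List Lab) : List (F5.LabeledPoly (Fin 4) K 2) :=
  G.map (Lab.toPoly K)

/-- The list of rules that is modelled by `rules`. -/
noncomputable def toRules (rules : RuleList) : F5.Rules (Fin 4) 2 :=
  rules.map fun a => (toSig a.1, a.2)

theorem exists_mem_map {α β : Type*} {f : α → β} {l : List α} {p : β → Prop} :
    (∃ b ∈ l.map f, p b) ↔ ∃ a ∈ l, p (f a) := by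
  simp

theorem faugereDetected_iff (G : List Lab) (u : Expo) (r : Lab) :
    F5.FaugereDetected (degRevLex 4) (toPolys K G) (toF u) (r.toPoly K) ↔
      faugere G u r = true := by
  simp only [F5.FaugereDetected, toPolys, exists_mem_map, ht_toPoly, faugere,
    List.any_eq_true, Bool.and_eq_true, decide_eq_true_eq]
  simp only [Lab.toPoly, toSig, ← toF_add, toF_le]

theorem rewritten_iff (rules : RuleList) (u : Expo) (r : Lab) :
    F5.Rewritten (toRules rules) (toF u) (r.toPoly K) ↔ rewritten rules u r = true := by
  simp only [F5.Rewritten, toRules, exists_mem_map, rewritten,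
    List.any_eq_true, Bool.and_eq_true, decide_eq_true_eq, beq_iff_eq, and_assoc]
  simp only [Lab.toPoly, toSig, ← toF_add, toF_le]

/-- The critical pair that is modelled by `p`. -/
noncomputable def Pair.toPair (p : Pair) : F5.CritPair (Fin 4) K 2 :=
  ⟨toF p.lcm, toF p.u₁, p.r₁.toPoly K, toF p.u₂, p.r₂.toPoly K⟩

theorem deg_toPair (p : Pair) : (p.toPair K).deg = deg p.lcm := degree_toF _

theorem orientedPair_toPoly (r s : Lab) :
    F5.orientedPair (degRevLex 4) (r.toPoly K) (s.toPoly K) = (orient r s).toPair K := by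
  have h : ∀ (u : Expo) (r : Lab), (r.toPoly K).sig.shift (toF u) = toSig (shift u r.sig) :=
    fun u r => shift_toSig u r.sig
  simp only [F5.orientedPair, ht_toPoly, ← toF_sup, ← toF_sub, h, lt_toSig_iff, orient]
  split_ifs <;> rfl

theorem critPair_toPoly (i : Fin 3) (G : List Lab) (r s : Lab) :
    F5.critPair (degRevLex 4) i (toPolys K G) (r.toPoly K) (s.toPoly K) =
      (crit i G r s).map (Pair.toPair K) := by
  have h1 : ∀ p : Pair, F5.FaugereDetected (degRevLex 4) (toPolys K G) (p.toPair K).u₁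
      (p.toPair K).r₁ ↔ faugere G p.u₁ p.r₁ = true := fun p => faugereDetected_iff K G p.u₁ p.r₁
  have h2 : ∀ p : Pair, F5.FaugereDetected (degRevLex 4) (toPolys K G) (p.toPair K).u₂
      (p.toPair K).r₂ ↔ faugere G p.u₂ p.r₂ = true := fun p => faugereDetected_iff K G p.u₂ p.r₂
  have h3 : ∀ p : Pair, (p.toPair K).r₁.sig.idx = p.r₁.sig.2 := fun _ => rfl
  have h4 : ∀ p : Pair, (p.toPair K).r₂.sig.idx = p.r₂.sig.2 := fun _ => rfl
  simp only [F5.critPair, orientedPair_toPoly, h1, h2, h3, h4, crit]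
  split_ifs <;> rfl

theorem filterMap_critPair (i : Fin 3) (G : List Lab) (r : Lab) :
    (toPolys K G).filterMap (F5.critPair (degRevLex 4) i (toPolys K G) (r.toPoly K)) =
      (G.filterMap (crit i G r)).map (Pair.toPair K) := by
  rw [List.map_filterMap]
  conv_lhs => rw [toPolys, List.filterMap_map]
  exact congrArg (fun f => List.filterMap f G) (funext fun s => critPair_toPoly K i G r s)

theorem insertBySig_toPoly (r : Lab) (l : List Lab) :
    F5.insertBySig (degRevLex 4) (r.toPoly K) (toPolys K l) = toPolys K (insertSig r l) := by
  classical
  symm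
  unfold F5.insertBySig insertSig
  refine List.map_orderedInsert _ _ _ _ _ ?_ ?_ <;>
  · intro a _
    simp only [F5.Signature.Le, Lab.toPoly, lt_toSig_iff, toSig_injective.eq_iff]

/-- The state of `Reduction` that is modelled by the data. -/
noncomputable def toRed (todo done : List Lab) (count : ℕ) (rules : RuleList) :
    F5.RedState (Fin 4) K 2 :=
  ⟨toPolys K todo, toPolys K done, count, toRules rules, []⟩

theorem spol_toPair (l : List Pair) (s t : SpolState) (h : spol l s = some t) :
    F5.spol (degRevLex 4) (l.map (Pair.toPair K)) (toRed K s.todo [] s.count s.rules) =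
      toRed K t.todo [] t.count t.rules := by
  induction l generalizing s with
  | nil =>
    rw [spol, Option.some_inj] at h
    rw [h]
    rfl
  | cons p ps ih =>
    have h1 : F5.Rewritten (toRules s.rules) (p.toPair K).u₁ (p.toPair K).r₁ ↔
      rewritten s.rules p.u₁ p.r₁ = true := rewritten_iff K s.rules p.u₁ p.r₁
    have h2 : F5.Rewritten (toRules s.rules) (p.toPair K).u₂ (p.toPair K).r₂ ↔
      rewritten s.rules p.u₂ p.r₂ = true := rewritten_iff K s.rules p.u₂ p.r₂
    simp only [spol, Bool.or_eq_true] at h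
    simp only [List.map_cons, F5.spol, toRed, h1, h2]
    split_ifs at h ⊢ with hr hc
    · exact ih s h
    · refine Eq.trans ?_ (ih _ h)
      have hpoly : MvPolynomial.monomial (p.toPair K).u₁ 1 * (p.toPair K).r₁.poly -
          MvPolynomial.monomial (p.toPair K).u₂ 1 * (p.toPair K).r₂.poly =
            binomial K (toFF (p.u₂ + p.r₂.bin.2, p.u₁ + p.r₁.bin.2)) := by
        simp only [Pair.toPair, Lab.toPoly, toFF, monomial_mul_binomial, ← toF_add, hc]
        simp only [binomial]
        ring
      have hsig : (p.toPair K).r₁.sig.shift (p.toPair K).u₁ = toSig (shift p.u₁ p.r₁.sig) :=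
        shift_toSig _ _
      rw [hpoly, hsig, toRed, ← insertBySig_toPoly]
      rfl

theorem isReducer_iff (i : Fin 3) (G : List Lab) (rules : RuleList) (r g : Lab) :
    F5.IsReducer (degRevLex 4) i (toPolys K G) (toRules rules) (r.toPoly K) (g.toPoly K) ↔
      isReducer i G rules r g = true := by
  have h : ∀ (u : Expo) (r : Lab), (r.toPoly K).sig.shift (toF u) = toSig (shift u r.sig) :=
    fun u r => shift_toSig u r.sig
  have h' : ∀ (s : Sig) (r : Lab), toSig s ≠ (r.toPoly K).sig ↔ s ≠ r.sig :=
    fun _ _ => toSig_injective.ne_iff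
  simp only [F5.IsReducer, ht_toPoly, ← toF_sub, faugereDetected_iff, rewritten_iff, h, toF_le,
    isReducer, Bool.and_eq_true, Bool.not_eq_true', beq_iff_eq, decide_eq_true_eq, and_assoc,
    Bool.not_eq_true, beq_eq_false_iff_ne, h']
  rfl

theorem polysAbove_toPolys (i : Fin 3) (G : List Lab) :
    F5.polysAbove i (toPolys K G) = binomial K '' binSet (binsAbove i G) := by
  ext p
  simp only [F5.polysAbove, toPolys, exists_mem_map, binSet, binsAbove, Set.mem_ofPred_eq,
    Set.mem_image, List.mem_filter, decide_eq_true_eq]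
  constructor
  · rintro ⟨r, hr, hi, rfl⟩
    exact ⟨_, ⟨r, ⟨hr, hi⟩, rfl⟩, rfl⟩
  · rintro ⟨_, ⟨r, ⟨hr, hi⟩, rfl⟩, rfl⟩
    exact ⟨r, hr, hi, rfl⟩

theorem toPolys_append (G H : List Lab) : toPolys K (G ++ H) = toPolys K G ++ toPolys K H :=
  List.map_append

/-- The loop of `Reduction` may be run longer than necessary. -/
theorem reduction_eq_some {σ : Type*} {m : ℕ} {ord : MonomialOrder σ} {i : Fin (m + 1)}
    {G : List (F5.LabeledPoly σ K m)} {s t : F5.RedState σ K m} {n : ℕ}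
    (h : (F5.reductionStep ord i G)^[n] s = t) (ht : t.todo = []) :
    F5.reduction ord i G s = some t := by
  classical
  have hex : ∃ n, ((F5.reductionStep ord i G)^[n] s).todo = [] := ⟨n, h ▸ ht⟩
  have hfix : ∀ (s : F5.RedState σ K m) (k : ℕ), s.todo = [] →
      (F5.reductionStep ord i G)^[k] s = s := by
    intro s k hs
    refine Function.iterate_fixed ?_ k
    rw [F5.reductionStep, hs]
  rw [F5.reduction, dif_pos hex, Option.some_inj, ← h]
  obtain ⟨k, hk⟩ := Nat.exists_eq_add_of_le (Nat.find_min' hex (h ▸ ht))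
  conv_rhs => rw [hk, Nat.add_comm, Function.iterate_add_apply]
  exact (hfix _ k (Nat.find_spec hex)).symm

theorem reductionStep_toRed (i : Fin 3) (G : List Lab) (rules : RuleList) (count : ℕ) (r : Lab)
    (rest done : List Lab) (hB : isGroebner (binsAbove i G) = true)
    (hn : isNormal (binsAbove i G) (reduceBin (binsAbove i G) fuel r.bin) = true)
    (h0 : (reduceBin (binsAbove i G) fuel r.bin).1 ≠ (reduceBin (binsAbove i G) fuel r.bin).2)
    (hred : ∀ g ∈ G ++ done, ¬ isReducer i (G ++ done) rules
      { r with bin := reduceBin (binsAbove i G) fuel r.bin } g = true) :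
    F5.reductionStep (degRevLex 4) i (toPolys K G) (toRed K (r :: rest) done count rules) =
      toRed K rest
        (done ++ [{ r with bin := monic (reduceBin (binsAbove i G) fuel r.bin) }]) count rules := by
  set p := reduceBin (binsAbove i G) fuel r.bin with hp
  have hnf : normalForm (degRevLex 4) (F5.polysAbove i (toPolys K G)) (r.toPoly K).poly =
      binomial K (toFF p) := by
    rw [polysAbove_toPolys]
    exact normalForm_binomial K hB hn
  have hne : (Lab.toPoly K { r with bin := p }).poly ≠ 0 := mt (binomial_toFF_eq_zero_iff K).1 h0
  have hfind : F5.findReducer (degRevLex 4) i (toPolys K G ++ toPolys K done) (toRules rules)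
      (Lab.toPoly K { r with bin := p }) = none := by
    rw [F5.findReducer, List.find?_eq_none, ← toPolys_append]
    intro g hg
    obtain ⟨g, hg', rfl⟩ := List.mem_map.1 hg
    simp only [decide_eq_true_eq, isReducer_iff]
    exact hred g hg'
  have hstep : F5.reductionStep (degRevLex 4) i (toPolys K G)
      (toRed K (r :: rest) done count rules) =
      F5.topReduction (degRevLex 4) i (toPolys K G) (Lab.toPoly K { r with bin := p })
        (toRed K rest done count rules) := by
    simp only [Lab.toPoly, ← hnf]
    rfl
  rw [hstep, F5.topReduction, if_neg hne]
  simp only [toRed, hfind]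
  simp [toPolys, Lab.toPoly, makeMonic_binomial_toFF K h0]

theorem exists_iterate_reductionStep (i : Fin 3) (G : List Lab) (rules : RuleList) (count : ℕ)
    (todo done done' : List Lab) (h : reduceAll i G rules todo done = some done') :
    ∃ n, (F5.reductionStep (degRevLex 4) i (toPolys K G))^[n] (toRed K todo done count rules) =
      toRed K [] done' count rules := by
  induction todo generalizing done with
  | nil =>
    rw [reduceAll, Option.some_inj] at h
    exact ⟨0, by rw [h]; rfl⟩
  | cons r rest ih =>
    simp only [reduceAll, Bool.and_eq_true, Bool.not_eq_true', List.any_eq_false,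
      beq_eq_false_iff_ne] at h
    split_ifs at h with hc
    obtain ⟨n, hn⟩ := ih _ h
    refine ⟨n + 1, ?_⟩
    rw [Function.iterate_succ_apply,
      reductionStep_toRed K i G rules count r rest done hc.1.1.1 hc.1.1.2 hc.1.2 hc.2, hn]

/-- The state of F5 that is modelled by `s`. -/
noncomputable def MState.toState (s : MState) : F5.State (Fin 4) K 2 :=
  ⟨s.cur, toPolys K s.G, s.pairs.map (Pair.toPair K), s.count, toRules s.rules, []⟩

theorem nextDegree_toState (s : MState) : (s.toState K).nextDegree = s.nextDegree := by
  simp only [F5.State.nextDegree, MState.toState, List.map_map, MState.nextDegree]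
  congr 2
  exact funext fun p => deg_toPair K p

theorem reduceDegree_toState {sel : List (F5.CritPair (Fin 4) K 2) → List (F5.CritPair (Fin 4) K 2)}
    {d : ℕ} {s : MState} {l : List Pair} {t : MRed}
    (hsel : sel ((s.pairsOfDegree d).map (Pair.toPair K)) = l.map (Pair.toPair K))
    (h : s.reduceDegree l = some t) :
    (s.toState K).reduceDegree (degRevLex 4) sel d = some (toRed K [] t.done t.count t.rules) := by
  have hf : (s.toState K).pairs.filter (fun p => p.deg = d) =
      (s.pairsOfDegree d).map (Pair.toPair K) := by
    simp only [MState.toState, List.filter_map, MState.pairsOfDegree]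
    congr 1
    refine List.filter_congr fun p _ => ?_
    simp [deg_toPair]
  rw [MState.reduceDegree] at h
  split at h
  · cases h
  rename_i t₁ ht₁
  split at h
  · cases h
  rename_i done hdone
  rw [Option.some_inj] at h
  subst h
  obtain ⟨n, hn⟩ := exists_iterate_reductionStep K s.cur s.G t₁.rules t₁.count _ _ _ hdone
  rw [F5.State.reduceDegree, hf, hsel]
  refine reduction_eq_some K (n := n) ?_ rfl
  · rw [← hn]
    exact congrArg _ (spol_toPair K l _ t₁ ht₁)

theorem addPoly_toState (s : MState) (r : Lab) :
    (s.toState K).addPoly (degRevLex 4) (r.toPoly K) = (s.addLab r).toState K := by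
  simp only [F5.State.addPoly, MState.toState, filterMap_critPair, MState.addLab, List.map_append,
    toPolys_append]
  rfl

theorem foldl_addPoly_toState (s : MState) (l : List Lab) :
    (toPolys K l).foldl (F5.State.addPoly (degRevLex 4)) (s.toState K) =
      (l.foldl MState.addLab s).toState K := by
  induction l generalizing s with
  | nil => rfl
  | cons r l ih => 
    rw [toPolys, List.map_cons, List.foldl_cons, List.foldl_cons, addPoly_toState]
    exact ih _

theorem finishDegree_toState (d : ℕ) (s : MState) (t : MRed) :
    (s.toState K).finishDegree (degRevLex 4) d (toRed K [] t.done t.count t.rules) =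
      (s.finishDegree d t).toState K := by
  rw [F5.State.finishDegree, MState.finishDegree, ← foldl_addPoly_toState]
  have hf : (s.toState K).pairs.filter (fun p => p.deg ≠ d) =
      (s.pairs.filter fun p => deg p.lcm ≠ d).map (Pair.toPair K) := by
    simp only [MState.toState, List.filter_map]
    congr 1
    refine List.filter_congr fun p _ => ?_
    simp [deg_toPair]
  rw [hf]
  rfl

theorem binomial_inputBin (i : Fin 3) : binomial K (toFF (inputBin i)) = faugereInput K i := by
  have h : ∀ a : Expo, MvPolynomial.monomial (toF a) (1 : K) =
      MvPolynomial.X 0 ^ a.1 * MvPolynomial.X 1 ^ a.2.1 * MvPolynomial.X 2 ^ a.2.2.1 *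
        MvPolynomial.X 3 ^ a.2.2.2 := by
    intro a
    rw [MvPolynomial.monomial_eq, Finsupp.prod_fintype _ _ (by simp), Fin.prod_univ_four]
    simp [toF]
  fin_cases i <;> simp [binomial, toFF, inputBin, faugereInput, h]

theorem inputPoly_faugereInput (i : Fin 3) :
    F5.inputPoly (degRevLex 4) (faugereInput K) i = (inputLab i).toPoly K := by
  have h : monic (inputBin i) = inputBin i ∧ (inputBin i).1 ≠ (inputBin i).2 := by
    revert i
    decide
  have h' : makeMonic (degRevLex 4) (faugereInput K i) = binomial K (toFF (inputBin i)) := by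
    rw [← binomial_inputBin, makeMonic_binomial_toFF K h.2, h.1]
  rw [F5.inputPoly, h', Lab.toPoly, inputLab, toSig, toF_zero]

theorem init_toState : F5.State.init (degRevLex 4) (faugereInput K) = MState.init.toState K := by
  rw [F5.State.init, inputPoly_faugereInput]
  rfl

theorem startIteration_toState (i : Fin 3) (s : MState) :
    (s.toState K).startIteration (degRevLex 4) (faugereInput K) i =
      (s.startIteration i).toState K := by
  simp only [F5.State.startIteration, MState.toState, inputPoly_faugereInput, filterMap_critPair,
    MState.startIteration, toPolys_append]
  rfl

theorem exists_perm_map_eq {α β : Type*} (f : α → β) {l : List α} {l' : List β}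
    (h : l'.Perm (l.map f)) : ∃ l₁ ∈ l.permutations', l' = l₁.map f := by
  rw [← List.mem_permutations', ← List.map_permutations', List.mem_map] at h
  obtain ⟨l₁, h₁, h₂⟩ := h
  exact ⟨l₁, h₁, h₂.symm⟩

theorem exists_run_of_allRuns
    {sel : List (F5.CritPair (Fin 4) K 2) → List (F5.CritPair (Fin 4) K 2)}
    (hsel : ∀ l, (sel l).Perm l) {check : MState → Bool} {n : ℕ} {s : MState}
    (h : allRuns check n s = true) {k : ℕ}
    (hk : F5.run (degRevLex 4) sel (faugereInput K) k = some (s.toState K)) :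
    ∃ s' : MState, check s' = true ∧
      F5.run (degRevLex 4) sel (faugereInput K) (k + n) = some (s'.toState K) := by
  induction n generalizing s k with
  | zero => exact ⟨s, h, hk⟩
  | succ n ih =>
    rw [show k + (n + 1) = (k + 1) + n by omega]
    rw [allRuns] at h
    split at h
    · rename_i d hd
      obtain ⟨l, hl, hl'⟩ := exists_perm_map_eq (Pair.toPair K)
        (hsel ((s.pairsOfDegree d).map (Pair.toPair K)))
      have h' := List.all_eq_true.1 h l hl
      split at h'
      · cases h'
      rename_i t ht
      refine ih h' ?_
      rw [F5.run, hk, Option.bind_some, F5.State.step, nextDegree_toState, hd]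
      simp only [reduceDegree_toState K hl' ht, Option.map_some, finishDegree_toState]
    · rename_i hd
      rw [Bool.and_eq_true, Bool.not_eq_true', beq_eq_false_iff_ne] at h
      refine ih h.2 ?_
      rw [F5.run, hk, Option.bind_some, F5.State.step, nextDegree_toState, hd]
      have hcur : (s.toState K).cur ≠ 0 := h.1
      simp only [if_neg hcur, startIteration_toState]
      have : (⟨(s.toState K).cur - 1, by omega⟩ : Fin 3) = s.cur - 1 := by
        rw [Fin.ext_iff]
        have : s.cur.val ≠ 0 := fun h0 => h.1 (Fin.ext h0)
        show s.cur.val - 1 = (s.cur - 1).val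
        generalize s.cur = c at this
        revert this
        revert c
        decide
      rw [this]

end Correctness

/-! #### The final state -/

section Final

variable (K : Type*) [Field K]

theorem polys_toPolys (G : List Lab) :
    F5.polys (toPolys K G) = binomial K '' binSet (G.map Lab.bin) := by
  ext p
  simp only [F5.polys, toPolys, exists_mem_map, binSet, Set.mem_ofPred_eq, Set.mem_image]
  constructor
  · rintro ⟨r, hr, rfl⟩
    exact ⟨_, ⟨r, hr, rfl⟩, rfl⟩
  · rintro ⟨_, ⟨r, hr, rfl⟩, rfl⟩
    exact ⟨r, hr, rfl⟩

theorem finite_binSet (B : List Bin) : (binSet B).Finite := by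
  have : binSet B = toFF '' {b | b ∈ B} := by
    ext q
    simp [binSet]
  rw [this]
  exact (List.finite_toSet B).image _

theorem monomial_mul_binomial_toFF (u : Expo) (p : Bin) :
    MvPolynomial.monomial (toF u) 1 * binomial K (toFF p) =
      binomial K (toFF (u + p.1, u + p.2)) := by
  rw [toFF, monomial_mul_binomial, toFF, toF_add, toF_add]

/-- If two binomials are in an ideal, then so is their s-polynomial. -/
theorem binomial_critBin_mem {I : Ideal (MvPolynomial (Fin 4) K)} {b c : Bin}
    (hb : binomial K (toFF b) ∈ I) (hc : binomial K (toFF c) ∈ I) :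
    binomial K (toFF (critBin b c)) ∈ I := by
  have h1 := I.mul_mem_left (MvPolynomial.monomial (toF (b.1 ⊔ c.1 - b.1)) 1) hb
  have h2 := I.mul_mem_left (MvPolynomial.monomial (toF (b.1 ⊔ c.1 - c.1)) 1) hc
  rw [monomial_mul_binomial_toFF, tsub_add_cancel_of_le le_sup_left] at h1
  rw [monomial_mul_binomial_toFF, tsub_add_cancel_of_le le_sup_right] at h2
  convert sub_mem h2 h1 using 1
  simp only [critBin, toFF, binomial]
  ring

theorem span_finalBasis :
    Ideal.span (binomial K '' binSet finalBasis) = Ideal.span (Set.range (faugereInput K)) := by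
  apply le_antisymm
  · rw [Ideal.span_le]
    rintro _ ⟨_, ⟨b, hb, rfl⟩, rfl⟩
    have hin : ∀ i, binomial K (toFF (inputBin i)) ∈ Ideal.span (Set.range (faugereInput K)) :=
      fun i => binomial_inputBin K i ▸ Ideal.subset_span ⟨i, rfl⟩
    have h3 := binomial_critBin_mem K (hin 1) (hin 2)
    have h4 := binomial_critBin_mem K h3 (hin 1)
    have h5 := binomial_critBin_mem K (hin 1) (hin 0)
    have h6 := binomial_critBin_mem K (hin 2) (hin 0)
    have h7 := binomial_critBin_mem K h4 h6
    have h8 := binomial_critBin_mem K h6 (hin 1)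
    simp only [finalBasis, List.mem_cons, List.not_mem_nil, or_false] at hb
    rcases hb with rfl | rfl | rfl | rfl | rfl | rfl | rfl | rfl | rfl
    exacts [hin 2, hin 1, h3, h4, hin 0, h5, h6, h7, h8]
  · rw [Ideal.span_le]
    rintro _ ⟨i, rfl⟩
    refine Ideal.subset_span ⟨_, ⟨inputBin i, ?_, rfl⟩, binomial_inputBin K i⟩
    revert i
    decide

theorem headIdeal_append (G H : List Lab) (hH : ∀ r ∈ H, ∃ g ∈ G, g.head ≤ r.head)
    (hG : ∀ g ∈ G, g.bin.1 ≠ g.bin.2) :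
    headIdeal (degRevLex 4) (F5.polys (toPolys K G ++ toPolys K H)) =
      headIdeal (degRevLex 4) (F5.polys (toPolys K G)) := by
  apply le_antisymm
  · refine Ideal.span_le.2 ?_
    rintro _ ⟨_, ⟨r, hr, rfl⟩, h0, rfl⟩
    rcases List.mem_append.1 hr with hr | hr
    · exact Ideal.subset_span ⟨_, ⟨r, hr, rfl⟩, h0, rfl⟩
    · obtain ⟨r, hr', rfl⟩ := List.mem_map.1 hr
      obtain ⟨g, hg, hle⟩ := hH r hr'
      have hmem : MvPolynomial.monomial (toF g.head) (1 : K) ∈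
          headIdeal (degRevLex 4) (F5.polys (toPolys K G)) :=
        Ideal.subset_span ⟨_, ⟨g.toPoly K, List.mem_map_of_mem hg, rfl⟩,
          mt (binomial_toFF_eq_zero_iff K).1 (hG g hg), by rw [← ht_toPoly K]; rfl⟩
      have : MvPolynomial.monomial ((degRevLex 4).degree (r.toPoly K).poly) (1 : K) =
          MvPolynomial.monomial (toF (r.head - g.head)) 1 *
            MvPolynomial.monomial (toF g.head) 1 := by
        rw [MvPolynomial.monomial_mul, one_mul, ← toF_add, tsub_add_cancel_of_le hle,
          ← ht_toPoly K]
        rfl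
      rw [this]
      exact Ideal.mul_mem_left _ _ hmem
  · refine Ideal.span_mono ?_
    rintro _ ⟨p, ⟨r, hr, rfl⟩, h⟩
    exact ⟨_, ⟨r, List.mem_append_left _ hr, rfl⟩, h⟩

end Final

end BinomialF5

open BinomialF5 in
theorem mainTheorem5 (K : Type*) [Field K]
    (sel : List (F5.CritPair (Fin 4) K 2) → List (F5.CritPair (Fin 4) K 2))
    (hsel : ∀ l, (sel l).Perm l) :
    ∃ (n : ℕ) (s : F5.State (Fin 4) K 2) (R : F5.RedState (Fin 4) K 2),
      F5.run (degRevLex 4) sel (faugereInput K) n = some s ∧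
      s.cur = 0 ∧
      s.nextDegree = some 8 ∧
      s.reduceDegree (degRevLex 4) sel 8 = some R ∧
      IsGroebnerUpTo (degRevLex 4) 7 (F5.polys s.G) (Ideal.span (Set.range (faugereInput K))) ∧
      R.done ≠ [] ∧
      headIdeal (degRevLex 4) (F5.polys (s.G ++ R.done)) =
        headIdeal (degRevLex 4) (F5.polys s.G) ∧
      R.zeros = [] := by
  obtain ⟨s, hs, hrun⟩ := exists_run_of_allRuns K hsel allRuns_finalCheck (k := 0)
    (congrArg some (init_toState K))
  simp only [finalCheck, Bool.and_eq_true, beq_iff_eq, List.all_eq_true] at hs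
  obtain ⟨⟨⟨hcur, hdeg⟩, hG⟩, hred⟩ := hs
  obtain ⟨l, hl, hl'⟩ := exists_perm_map_eq (Pair.toPair K)
    (hsel ((s.pairsOfDegree 8).map (Pair.toPair K)))
  have h := hred l hl
  split at h
  · cases h
  rename_i t ht
  simp only [Bool.and_eq_true, Bool.not_eq_true', List.isEmpty_eq_false_iff, List.all_eq_true,
    List.any_eq_true, decide_eq_true_eq] at h
  have hpolys : F5.polys (s.toState K).G = binomial K '' binSet finalBasis := by
    rw [← hG]
    exact polys_toPolys K s.G
  refine ⟨_, s.toState K, _, hrun, hcur, (nextDegree_toState K s).trans hdeg,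
    reduceDegree_toState K hl' ht, ?_, ?_, ?_, rfl⟩
  · rw [hpolys]
    exact ⟨(finite_binSet _).image _, span_finalBasis K,
      hasStdRep_sPolynomial K isGroebnerUpTo_finalBasis⟩
  · simpa [toRed, toPolys] using h.1
  · refine headIdeal_append K s.G t.done h.2 fun g hg => ?_
    have hne : ∀ b ∈ finalBasis, b.1 ≠ b.2 := by decide
    exact hne _ (hG ▸ List.mem_map_of_mem hg)
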